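/- Fix a computable enumeration $f_0, f_1, f_2, \ldots$ of all polynomials with integer coefficients in any finite number of variables. For a commutative ring $R$ let $\operatorname{HTP}(R)$ be the set of indices $e$ such that $f_e$ has a root in $R^k$ for the appropriate $k$. For a set $S$ of primes let $\mathbb{Z}[S^{-1}]$ be the subring of $\mathbb{Q}$ generated by the inverses of the elements of $S$, and let the upper density of $S$ be $\limsup_{n \to \infty} |S \cap \{p_1, \ldots, p_n\}|/n$, where $p_1 < p_2 < \cdots$ are all the primes in increasing order. For sets $A, B$ of natural numbers, write $A \leq_T B$ if $A$ is Turing reducible to $B$, that is, if the characteristic function of $A$ is computable with an oracle for that of $B$. Theorem. For every positive integer $m$, the set of all rational primes is a union of pairwise disjoint sets $S_1, \ldots, S_m$ such that, for every $i \in \{1, \ldots, m\}$, the set $S_i$ has upper density $1$, $\operatorname{HTP}(\mathbb{Z}[S_i^{-1}]) \leq_T \operatorname{HTP}(\mathbb{Q})$, and $S_i \leq_T \operatorname{HTP}(\mathbb{Q})$. -/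

import Mathlib

open Filter
open scoped Computability

noncomputable section

namespace HTP

/-- A presentation of a polynomial with integer coefficients as a finite list of terms: the pair
`(c, [i₁, …, i_k])` stands for the term `c * X_{i₁} * ⋯ * X_{i_k}`. -/
abbrev PolyCode : Type := List (ℤ × List ℕ)

/-- The polynomial in `ℤ[X_0, X_1, …]` presented by a code. -/
def PolyCode.toPoly (L : PolyCode) : MvPolynomial ℕ ℤ :=
  (L.map fun t => MvPolynomial.C t.1 * (t.2.map MvPolynomial.X).prod).sum

/-- The fixed computable enumeration `f_0, f_1, …` of all polynomials over `ℤ` in any number of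
variables: `f_e` is presented by the code with number `e` in Mathlib's (primitive recursive)
numbering of lists of pairs of integers and lists of natural numbers. -/
def polyEnum (e : ℕ) : MvPolynomial ℕ ℤ :=
  PolyCode.toPoly (Denumerable.ofNat PolyCode e)

theorem PolyCode.toPoly_append (L M : PolyCode) :
    PolyCode.toPoly (L ++ M) = PolyCode.toPoly L + PolyCode.toPoly M := by
  simp [PolyCode.toPoly]

/-- Every polynomial is enumerated. -/
theorem polyEnum_surjective : Function.Surjective polyEnum := by
  have key : ∀ p : MvPolynomial ℕ ℤ, ∃ L : PolyCode, PolyCode.toPoly L = p := by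
    intro p
    induction p using MvPolynomial.induction_on with
    | C a => exact ⟨[(a, [])], by simp [PolyCode.toPoly]⟩
    | add p q hp hq =>
      obtain ⟨L, rfl⟩ := hp
      obtain ⟨M, rfl⟩ := hq
      exact ⟨L ++ M, PolyCode.toPoly_append L M⟩
    | mul_X p n hp =>
      obtain ⟨L, rfl⟩ := hp
      refine ⟨L.map fun t => (t.1, n :: t.2), ?_⟩
      induction L with
      | nil => simp [PolyCode.toPoly]
      | cons t L ih =>
        simp only [PolyCode.toPoly, List.map_cons, List.sum_cons, List.prod_cons] at ih ⊢
        rw [ih]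
        ring
  intro p
  obtain ⟨L, hL⟩ := key p
  exact ⟨Encodable.encode L, by simpa [polyEnum] using hL⟩

/-- The code of `f_e` is a computable function of the index `e`. -/
theorem computable_code : Computable fun e : ℕ => Denumerable.ofNat PolyCode e :=
  Computable.ofNat PolyCode

end HTP

/-- `HTP(R)`: the set of indices of the polynomials over `ℤ` that have a root in `R`. As only
finitely many variables occur in a polynomial, a root in `R^k` for the appropriate `k` is the same
as a root in `R^ℕ`. -/
def hilbertTenth (R : Type*) [CommRing R] : Set ℕ :=
  {e | ∃ x : ℕ → R, MvPolynomial.aeval x (HTP.polyEnum e) = 0}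

/-- The subring `ℤ[S⁻¹]` of `ℚ`, generated by the inverses of the elements of `S`. -/
def invertedSubring (S : Set ℕ) : Subring ℚ :=
  Subring.closure ((fun p : ℕ => (p : ℚ)⁻¹) '' S)

/-- The characteristic function of a set of natural numbers. -/
def charFun (A : Set ℕ) : ℕ → ℕ := A.indicator 1

/-- Turing reducibility of sets: the characteristic function of `A` is computable with an oracle
for the characteristic function of `B`. -/
def SetTuringReducible (A B : Set ℕ) : Prop :=
  (charFun A : ℕ →. ℕ) ≤ᵀ (charFun B : ℕ →. ℕ)

open scoped Classical in
/-- The upper density of a set `S` of primes: the limsup of the proportion of elements of `S` among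
the first `n` primes (`Nat.nth Nat.Prime 0 = 2`, `Nat.nth Nat.Prime 1 = 3`, …). -/
def primeUpperDensity (S : Set ℕ) : ℝ :=
  limsup (fun n : ℕ =>
    (((Finset.range n).filter fun i => Nat.nth Nat.Prime i ∈ S).card : ℝ) / (n : ℝ)) atTop

end

/-! The primes are distributed in stages. Thresholds `0 = t_0 < t_1 < ⋯` are built one at a time,
and the primes in `[t_s, t_{s+1})` join the class `s % m`. Stage `s = m * e + i` settles whether
`f_e` has a root in `ℤ[S_i⁻¹]`: the oracle is asked whether `f_e` has a rational root whose
denominators avoid the finitely many primes below `t_s` already given to other classes. If not, no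
later choice can create a root. If so, a search finds a root with common denominator `d`, and
`t_{s+1}` is taken above `d`, so that all prime divisors of `d` lie in `S_i`. The answer is
therefore correct for the final set (`mem_hilbertTenth_primeClass_iff`), and everything is
computable from `HTP(ℚ)`. Each `t_{s+1}` also has at least `(s + 1) * (t_s + 1)` primes below it, so
a proportion of at least `1 - 1/(s + 1)` of them is in the class `s % m`; each class has infinitely
many stages, hence upper density `1`.

The question is one about `ℚ` because integrality at `p` is existentially definable over `ℚ`,
effectively in `p` (`IsAuxPrime.not_dvd_den_iff`). For a suitable prime `c` the quaternion algebra
`(c, p)` is ramified at `p`; its norm form is anisotropic over `ℚ_p`, so the coordinates of norm-one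
elements are `p`-integral up to a factor `2`. Conversely, every `4 * (N ^ p - N) ^ 2` with `N` an
integer is such a coordinate. The `v` for which `4 * (v ^ p - v) ^ 2` is a coordinate thus form a
set between `ℤ` and `ℤ_(p)`, and `ℤ_(p)` consists of the quotients `y / (1 + p z)` with `y`, `z` in
it. Sums of squares merge all conditions into one polynomial. -/

/-! ### Ternary quadratic forms -/

/-- A weak form of Legendre's theorem on ternary quadratic forms: if `a` and `b` are coprime and
squares modulo each other, then `b` is a norm from `ℚ(√a)`. -/
theorem exists_sq_sub_mul_sq_eq (a b : ℕ) (ha : 0 < a) (hb : 0 < b) (hab : a.Coprime b)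
    (r t : ℤ) (hr : (b : ℤ) ∣ r ^ 2 - a) (ht : (a : ℤ) ∣ t ^ 2 - b) :
    ∃ x y : ℚ, x ^ 2 - a * y ^ 2 = b := by
  by_cases hsa : IsSquare a
  · obtain ⟨s, rfl⟩ := hsa
    have hs : (s : ℚ) ≠ 0 := by
      rintro h
      simp_all
    -- Solves `x - s y = 1`, `x + s y = b`.
    refine ⟨(b + 1) / 2, (b - 1) / (2 * s), ?_⟩
    push_cast
    field_simp
    ring
  by_cases hsb : IsSquare b
  · obtain ⟨s, rfl⟩ := hsb
    exact ⟨s, 0, by push_cast; ring⟩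
  have hint : ∃ x y z : ℤ, z ≠ 0 ∧ x ^ 2 - a * y ^ 2 = b * z ^ 2 := by
    -- Thue's pigeonhole argument: the box has more than `a * b` points, so two agree modulo both
    -- congruences; their difference is the small solution.
    have hbox : ∃ x y z : ℤ, (x ≠ 0 ∨ y ≠ 0 ∨ z ≠ 0) ∧ (b : ℤ) ∣ x - r * y ∧ (a : ℤ) ∣ x - t * z ∧
        x ^ 2 ≤ a * b ∧ y ^ 2 ≤ b ∧ z ^ 2 ≤ a := by
      let box : Finset (ℕ × ℕ × ℕ) := Finset.range ((a * b).sqrt + 1) ×ˢ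
        Finset.range (b.sqrt + 1) ×ˢ Finset.range (a.sqrt + 1)
      have : NeZero a := ⟨ha.ne'⟩
      have : NeZero b := ⟨hb.ne'⟩
      let f : ℕ × ℕ × ℕ → ZMod b × ZMod a := fun v =>
        (((v.1 - r * v.2.1 : ℤ) : ZMod b), ((v.1 - t * v.2.2 : ℤ) : ZMod a))
      have hcard : (Finset.univ : Finset (ZMod b × ZMod a)).card < box.card := by
        simp only [box, Finset.card_univ, Fintype.card_prod, ZMod.card, Finset.card_product,
          Finset.card_range]
        have h1 := Nat.lt_succ_sqrt (a * b)
        have h2 := Nat.lt_succ_sqrt b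
        have h3 := Nat.lt_succ_sqrt a
        simp only [Nat.succ_eq_add_one] at h1 h2 h3
        by_contra! hle
        have h4 := Nat.mul_lt_mul'' h1 (Nat.mul_lt_mul'' h2 h3)
        nlinarith [Nat.mul_le_mul hle hle]
      obtain ⟨v, hv, w, hw, hne, hvw⟩ :=
        Finset.exists_ne_map_eq_of_card_lt_of_maps_to (f := f) hcard (fun _ _ => Finset.mem_univ _)
      have hsq : ∀ {n k l : ℕ}, k < n.sqrt + 1 → l < n.sqrt + 1 → ((k : ℤ) - l) ^ 2 ≤ n := by
        intro n k l hk hl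
        have h1 : ((n.sqrt : ℤ)) ^ 2 ≤ n := by exact_mod_cast Nat.sqrt_le' n
        have h2 : |(k : ℤ) - l| ≤ |(n.sqrt : ℤ)| := by
          rw [abs_of_nonneg (by positivity : (0 : ℤ) ≤ n.sqrt), abs_le]
          constructor <;> omega
        exact (sq_le_sq.2 h2).trans h1
      simp only [box, Finset.mem_product, Finset.mem_range] at hv hw
      obtain ⟨h1, h2⟩ := Prod.ext_iff.1 hvw
      refine ⟨v.1 - w.1, v.2.1 - w.2.1, v.2.2 - w.2.2, ?_, ?_, ?_, ?_, hsq hv.2.1 hw.2.1,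
        hsq hv.2.2 hw.2.2⟩
      · by_contra! h
        refine hne (Prod.ext ?_ (Prod.ext ?_ ?_)) <;> omega
      · rw [← ZMod.intCast_eq_intCast_iff_dvd_sub] at *
        simp only [f] at h1
        push_cast at h1 ⊢
        linear_combination -h1
      · rw [← ZMod.intCast_eq_intCast_iff_dvd_sub] at *
        simp only [f] at h2
        push_cast at h2 ⊢
        linear_combination -h2
      · exact_mod_cast hsq hv.1 hw.1
    obtain ⟨x, y, z, hne, h1, h2, hx, hy, hz⟩ := hbox
    have hsqZ : ∀ {n : ℕ} {k : ℤ}, ¬ IsSquare n → k ^ 2 ≠ n := by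
      intro n k hn h
      refine hn ⟨k.natAbs, ?_⟩
      zify
      rw [← h, ← sq, sq_abs]
    have hy' : y ^ 2 < b := lt_of_le_of_ne hy (hsqZ hsb)
    have hz' : z ^ 2 < a := lt_of_le_of_ne hz (hsqZ hsa)
    have hdvd : ((a : ℤ) * b) ∣ x ^ 2 - a * y ^ 2 - b * z ^ 2 := by
      refine IsCoprime.mul_dvd (by exact_mod_cast hab) ?_ ?_
      · have : x ^ 2 - a * y ^ 2 - b * z ^ 2
          = (x - t * z) * (x + t * z) + (t ^ 2 - b) * z ^ 2 - a * y ^ 2 := by ring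
        rw [this]
        exact (dvd_add (h2.mul_right _) (ht.mul_right _)).sub (dvd_mul_right _ _)
      · have : x ^ 2 - a * y ^ 2 - b * z ^ 2
          = (x - r * y) * (x + r * y) + (r ^ 2 - a) * y ^ 2 - b * z ^ 2 := by ring
        rw [this]
        exact (dvd_add (h1.mul_right _) (hr.mul_right _)).sub (dvd_mul_right _ _)
    obtain ⟨k, hk⟩ := hdvd
    have ha' : (0 : ℤ) < a := by exact_mod_cast ha
    have hb' : (0 : ℤ) < b := by exact_mod_cast hb
    have hab' : (0 : ℤ) < a * b := by positivity
    -- The size bounds leave only the values `0`, `-ab` and `ab` for the form; the last would force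
    -- `x ^ 2 = a * b`, making the coprime factor `a` a square.
    have hk1 : k ≤ 1 := by
      by_contra! h
      nlinarith [mul_nonneg ha'.le (sq_nonneg y), mul_nonneg hb'.le (sq_nonneg z)]
    have hk2 : -2 < k := by
      by_contra! h
      nlinarith [mul_lt_mul_of_pos_left hy' ha', mul_lt_mul_of_pos_left hz' hb', sq_nonneg x]
    have hk3 : k ≠ 1 := by
      rintro rfl
      have hxx : (a : ℤ) * b = x ^ 2 := by
        nlinarith [mul_nonneg ha'.le (sq_nonneg y), mul_nonneg hb'.le (sq_nonneg z)]
      obtain ⟨w, hw | hw⟩ := Int.sq_of_isCoprime (by exact_mod_cast hab) hxx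
      · exact hsqZ hsa hw.symm
      · nlinarith [sq_nonneg w]
    have hk' : k = 0 ∨ k = -1 := by omega
    rcases hk' with rfl | rfl
    · refine ⟨x, y, z, ?_, by linarith⟩
      rintro rfl
      have hxy : x ^ 2 = a * y ^ 2 := by linarith
      by_cases hy0 : y = 0
      · subst hy0
        simp_all
      · apply hsa
        rw [← Rat.isSquare_natCast_iff]
        refine ⟨x / y, ?_⟩
        have : (y : ℚ) ≠ 0 := by exact_mod_cast hy0
        field_simp
        exact_mod_cast (by linarith)
    -- Here `x ^ 2 - a y ^ 2 = b (z ^ 2 - a)`; multiplying by the norm `z ^ 2 - a` of `z + √a` gives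
    -- `b` times a square.
    · refine ⟨x * z + a * y, x + y * z, z ^ 2 - a, by linarith, ?_⟩
      linear_combination (z ^ 2 - a) * hk
  obtain ⟨x, y, z, hz, h⟩ := hint
  have hz' : (z : ℚ) ≠ 0 := by exact_mod_cast hz
  refine ⟨x / z, y / z, ?_⟩
  field_simp
  rw [mul_comm (_ ^ 2) (b : ℚ)]
  exact_mod_cast h

/-! ### Quaternion algebras and the diophantine definition of `ℤ_(p)` -/

/-- The auxiliary primes `c` for which the quaternion algebra `(c, p)` over `ℚ` is ramified at `p`
and at `c` only. -/
def IsAuxPrime (p c : ℕ) : Prop := c.Prime ∧ c % 8 = 5 ∧ ∀ y < c, y * y % c ≠ p % c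

/-- `X` is half the trace of an element of norm `1` in the quaternion algebra `(c, p)`
(scaled by `√c`). -/
def IsQuatTrace (p c : ℕ) (X : ℚ) : Prop :=
  ∃ u a b : ℚ, 1 + c * X ^ 2 = u ^ 2 - p * (a ^ 2 - c * b ^ 2)

theorem IsAuxPrime.not_isSquare {p c : ℕ} (h : IsAuxPrime p c) : ¬ IsSquare (p : ZMod c) := by
  have : NeZero c := ⟨h.1.ne_zero⟩
  rintro ⟨y, hy⟩
  refine h.2.2 y.val y.val_lt ?_
  rw [← Nat.ModEq, ← ZMod.natCast_eq_natCast_iff]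
  simp [hy]

theorem isAuxPrime_of_not_isSquare {p c : ℕ} (hc : c.Prime) (h5 : c % 8 = 5)
    (h : ¬ IsSquare (p : ZMod c)) : IsAuxPrime p c := by
  refine ⟨hc, h5, fun y _ hy => h ⟨y, ?_⟩⟩
  rw [← Nat.ModEq, ← ZMod.natCast_eq_natCast_iff] at hy
  rw [← hy]
  push_cast
  rfl

theorem IsAuxPrime.not_isSquare' {p c : ℕ} (h : IsAuxPrime p c) (hp : p.Prime) (hp2 : p ≠ 2) :
    ¬ IsSquare (c : ZMod p) := by
  have : Fact p.Prime := ⟨hp⟩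
  have : Fact c.Prime := ⟨h.1⟩
  rw [← ZMod.exists_sq_eq_prime_iff_of_mod_four_eq_one (by have := h.2.1; omega) hp2]
  exact h.not_isSquare

theorem IsAuxPrime.ne {p c : ℕ} (h : IsAuxPrime p c) : p ≠ c := by
  rintro rfl
  exact h.not_isSquare (by simp)

/-- Dirichlet's theorem gives a prime `c ≡ 5 (mod 8)` that is a nonresidue modulo an odd `p`; as `c
≡ 1 (mod 4)`, reciprocity makes `p` a nonresidue modulo `c`. -/
theorem exists_isAuxPrime {p : ℕ} (hp : p.Prime) : ∃ c, IsAuxPrime p c := by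
  rcases eq_or_ne p 2 with rfl | hp2
  · exact ⟨5, by norm_num, by norm_num, by decide⟩
  have : Fact p.Prime := ⟨hp⟩
  obtain ⟨a, ha⟩ := FiniteField.exists_nonsquare (F := ZMod p) (by simpa [ZMod.ringChar_zmod_n])
  have hcop : Nat.Coprime 8 p := by
    rw [Nat.coprime_comm, hp.coprime_iff_not_dvd]
    intro h
    exact hp2 ((Nat.prime_dvd_prime_iff_eq hp Nat.prime_two).1 (hp.dvd_of_dvd_pow (n := 3) h))
  obtain ⟨x, hx8, hxp⟩ := Nat.chineseRemainder hcop 5 a.val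
  have hxp' : (x : ZMod p) = a := by
    rw [← ZMod.natCast_eq_natCast_iff] at hxp
    simpa using hxp
  have hx : x.Coprime (8 * p) := by
    refine Nat.Coprime.mul_right ?_ ?_
    · rw [Nat.Coprime, hx8.gcd_eq]
      rfl
    · rw [Nat.coprime_comm, hp.coprime_iff_not_dvd, ← ZMod.natCast_eq_zero_iff, hxp']
      rintro rfl
      exact ha (by simp)
  obtain ⟨c, -, hc, hcx⟩ := Nat.forall_exists_prime_gt_and_modEq 0 (by simp [hp.ne_zero]) hx
  have : Fact c.Prime := ⟨hc⟩
  have hc8 : c % 8 = 5 := (hcx.of_mul_right p).trans hx8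
  refine ⟨c, isAuxPrime_of_not_isSquare hc hc8 ?_⟩
  rw [ZMod.exists_sq_eq_prime_iff_of_mod_four_eq_one (by omega) hp2]
  have h1 := (hcx.of_mul_left 8)
  rw [← ZMod.natCast_eq_natCast_iff] at h1
  rwa [h1, hxp']

theorem dvd_and_dvd_of_dvd_sq_sub {p : ℕ} [Fact p.Prime] {c : ℕ} (hc : ¬ IsSquare (c : ZMod p))
    {x y : ℤ} (h : (p : ℤ) ∣ x ^ 2 - c * y ^ 2) : (p : ℤ) ∣ x ∧ (p : ℤ) ∣ y := by
  simp only [← ZMod.intCast_zmod_eq_zero_iff_dvd] at h ⊢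
  push_cast at h
  have hy : (y : ZMod p) = 0 := by
    by_contra hy
    refine hc ⟨x / y, ?_⟩
    field_simp
    linear_combination -h
  refine ⟨?_, hy⟩
  simpa [hy] using h

/-- The anisotropy of the norm form at an odd prime `p`. -/
theorem dvd_of_quat_eq {p : ℕ} [Fact p.Prime] {c : ℕ} (hc : ¬ IsSquare (c : ZMod p))
    {W X U A B : ℤ} (h : W ^ 2 + c * X ^ 2 = U ^ 2 - p * (A ^ 2 - c * B ^ 2)) (hW : (p : ℤ) ∣ W) :
    (p : ℤ) ∣ X ∧ (p : ℤ) ∣ U ∧ (p : ℤ) ∣ A ∧ (p : ℤ) ∣ B := by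
  obtain ⟨w, rfl⟩ := hW
  obtain ⟨⟨u, rfl⟩, ⟨x, rfl⟩⟩ := dvd_and_dvd_of_dvd_sq_sub (p := p) hc (x := U) (y := X)
    ⟨p * w ^ 2 + (A ^ 2 - c * B ^ 2), by linear_combination -h⟩
  have hp : (p : ℤ) ≠ 0 := by exact_mod_cast (Fact.out : p.Prime).ne_zero
  obtain ⟨hA, hB⟩ := dvd_and_dvd_of_dvd_sq_sub (p := p) hc (x := A) (y := B)
    ⟨u ^ 2 - c * x ^ 2 - w ^ 2, by
      apply mul_left_cancel₀ hp
      linear_combination h⟩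
  exact ⟨dvd_mul_right _ _, dvd_mul_right _ _, hA, hB⟩

/-- For `c ≡ 5 (mod 8)` the extension `ℚ_2(√c)` is unramified, so norms have even valuation. The
odd-odd case reflects the integers `(x + y√c) / 2`. -/
theorem sq_sub_mul_sq_emod_eight {c : ℕ} (hc : c % 8 = 5) (x y : ℤ) :
    (x ^ 2 - c * y ^ 2) % 4 ≠ 2 ∧ ((x ^ 2 - c * y ^ 2) % 2 = 0 →
      (x % 2 = 0 ∧ y % 2 = 0) ∨ (x % 2 = 1 ∧ y % 2 = 1 ∧ (x ^ 2 - c * y ^ 2) % 8 = 4)) := by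
  obtain ⟨k, hk⟩ : ∃ k : ℤ, (c : ℤ) = 8 * k + 5 := ⟨c / 8, by omega⟩
  have hsq : ∀ z : ℤ, (z % 2 = 0 ∧ z ^ 2 % 4 = 0) ∨ (z % 2 = 1 ∧ z ^ 2 % 8 = 1) := by
    intro z
    rcases Int.emod_two_eq_zero_or_one z with h | h
    · obtain ⟨t, rfl⟩ := Int.dvd_of_emod_eq_zero h
      exact Or.inl ⟨h, Int.emod_eq_zero_of_dvd ⟨t ^ 2, by ring⟩⟩
    · obtain ⟨t, rfl⟩ := Int.odd_iff.2 h
      obtain ⟨s, hs⟩ := (Int.even_mul_succ_self t).two_dvd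
      have : (2 * t + 1) ^ 2 = 8 * s + 1 := by linear_combination 4 * hs
      exact Or.inr ⟨h, by omega⟩
  have h : x ^ 2 - c * y ^ 2 = x ^ 2 - 8 * (k * y ^ 2) - 5 * y ^ 2 := by rw [hk]; ring
  rw [h]
  generalize k * y ^ 2 = m
  rcases hsq x with hx | hx <;> rcases hsq y with hy | hy <;>
    generalize x ^ 2 = X at * <;> generalize y ^ 2 = Y at * <;> omega

/-- The anisotropy of the norm form at the prime `2`. -/
theorem two_dvd_of_quat_eq {c : ℕ} (hc : c % 8 = 5)
    {W X U A B : ℤ} (h : W ^ 2 + c * X ^ 2 = U ^ 2 - 2 * (A ^ 2 - c * B ^ 2)) (hW : 4 ∣ W) :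
    2 ∣ X ∧ 2 ∣ U ∧ 2 ∣ A ∧ 2 ∣ B := by
  obtain ⟨w, rfl⟩ := hW
  have h1 : 16 * w ^ 2 = (U ^ 2 - c * X ^ 2) - 2 * (A ^ 2 - c * B ^ 2) := by linear_combination h
  have hUX := sq_sub_mul_sq_emod_eight hc U X
  have hAB := sq_sub_mul_sq_emod_eight hc A B
  have hUX2 : U % 2 = 0 ∧ X % 2 = 0 := by
    generalize w ^ 2 = w' at *
    generalize U ^ 2 - c * X ^ 2 = P at *
    generalize A ^ 2 - c * B ^ 2 = Q at *
    omega
  obtain ⟨u, rfl⟩ := Int.dvd_of_emod_eq_zero hUX2.1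
  obtain ⟨x, rfl⟩ := Int.dvd_of_emod_eq_zero hUX2.2
  have hux := sq_sub_mul_sq_emod_eight hc u x
  have h2 : 16 * w ^ 2 = 4 * (u ^ 2 - c * x ^ 2) - 2 * (A ^ 2 - c * B ^ 2) := by
    linear_combination h1
  refine ⟨dvd_mul_right _ _, dvd_mul_right _ _, ?_⟩
  clear h h1 hUX hUX2
  generalize w ^ 2 = w' at *
  generalize u ^ 2 - c * x ^ 2 = P at *
  generalize A ^ 2 - c * B ^ 2 = Q at *
  omega

/-- Infinite descent on `|W|`: if `p` divided the denominator, anisotropy would make all five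
variables divisible by `p`, and dividing them by `p` leaves `X / W` unchanged. -/
theorem IsAuxPrime.not_dvd_den_of_quat_eq {p c : ℕ} (hp : p.Prime) (hc : IsAuxPrime p c) (n : ℕ) :
    ∀ W X U A B : ℤ, W.natAbs = n → W ≠ 0 →
      W ^ 2 + c * X ^ 2 = U ^ 2 - p * (A ^ 2 - c * B ^ 2) → ¬ p ∣ (2 * (X / W : ℚ)).den := by
  have : Fact p.Prime := ⟨hp⟩
  have hp0 : (p : ℤ) ≠ 0 := by exact_mod_cast hp.ne_zero
  have hpq : (p : ℚ) ≠ 0 := by exact_mod_cast hp.ne_zero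
  induction n using Nat.strong_induction_on with
  | _ n ih =>
    intro W X U A B hn hW h hden
    have hdvd : ∀ {Y V : ℤ}, 2 * (X / W : ℚ) = Y / V → (p : ℤ) ∣ V := by
      intro Y V hYV
      rw [hYV, ← Rat.divInt_eq_div] at hden
      exact (Int.natCast_dvd_natCast.2 hden).trans (Rat.den_dvd Y V)
    have hpW : (p : ℤ) ∣ W := hdvd (Y := 2 * X) (by push_cast; ring)
    have hall : (p : ℤ) ∣ X ∧ (p : ℤ) ∣ U ∧ (p : ℤ) ∣ A ∧ (p : ℤ) ∣ B := by
      rcases eq_or_ne p 2 with rfl | hp2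
      · refine two_dvd_of_quat_eq hc.2.1 h ?_
        obtain ⟨w, rfl⟩ := hpW
        -- The factor `2` in `2 * (X / W)` supplies the second power of `2` in `W` that the dyadic
        -- argument needs.
        obtain ⟨v, rfl⟩ : ((2 : ℕ) : ℤ) ∣ w := hdvd (Y := X) (by push_cast; field_simp)
        exact ⟨v, by push_cast; ring⟩
      · exact dvd_of_quat_eq (hc.not_isSquare' hp hp2) h hpW
    obtain ⟨w, rfl⟩ := hpW
    obtain ⟨⟨x, rfl⟩, ⟨u, rfl⟩, ⟨a, rfl⟩, ⟨b, rfl⟩⟩ := hall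
    have hw : w ≠ 0 := right_ne_zero_of_mul hW
    refine ih w.natAbs ?_ w x u a b rfl hw ?_ ?_
    · rw [← hn, Int.natAbs_mul, Int.natAbs_natCast]
      exact lt_mul_of_one_lt_left (Int.natAbs_pos.2 hw) hp.one_lt
    · apply mul_left_cancel₀ (pow_ne_zero 2 hp0)
      linear_combination h
    · convert hden using 3
      push_cast
      field_simp

theorem IsQuatTrace.not_dvd_den {p c : ℕ} (hp : p.Prime) (hc : IsAuxPrime p c) {X : ℚ}
    (hX : IsQuatTrace p c X) : ¬ p ∣ (2 * X).den := by
  obtain ⟨u, a, b, h⟩ := hX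
  have hX0 : (X.den : ℚ) ≠ 0 := by simp
  have hu0 : (u.den : ℚ) ≠ 0 := by simp
  have ha0 : (a.den : ℚ) ≠ 0 := by simp
  have hb0 : (b.den : ℚ) ≠ 0 := by simp
  have hXe := X.num_div_den
  have hue := u.num_div_den
  have hae := a.num_div_den
  have hbe := b.num_div_den
  have key := hc.not_dvd_den_of_quat_eq hp _ (X.den * u.den * a.den * b.den)
    (X.num * u.den * a.den * b.den) (X.den * u.num * a.den * b.den)
    (X.den * u.den * a.num * b.den) (X.den * u.den * a.den * b.num) rfl (by simp) ?_
  · convert key using 3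
    have hXn : (X.num : ℚ) = X * X.den := by rw [Rat.mul_den_eq_num]
    push_cast
    rw [hXn]
    field_simp
  · rw [← hXe, ← hue, ← hae, ← hbe] at h
    field_simp at h
    have h' : ((X.den * u.den * a.den * b.den) ^ 2 + c * (X.num * u.den * a.den * b.den) ^ 2 : ℚ) =
      (X.den * u.num * a.den * b.den) ^ 2 - p * ((X.den * u.den * a.num * b.den) ^ 2
        - c * (X.den * u.den * a.den * b.num) ^ 2) := by
      linear_combination h
    exact_mod_cast h'

/-- A factor `p` in the denominator of `v` would put `p ^ (2 * p)` into that of `(v ^ p - v) ^ 2`.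
Integrality of twice the coordinate then forces `p ^ (2 * p) ∣ 8`, which fails even for `p = 2`. -/
theorem not_dvd_den_of_isQuatTrace {p c : ℕ} (hp : p.Prime) (hc : IsAuxPrime p c) {v : ℚ}
    (hv : IsQuatTrace p c (4 * (v ^ p - v) ^ 2)) : ¬ p ∣ v.den := by
  intro hdvd
  have hX := hv.not_dvd_den hp hc
  obtain ⟨n, hn⟩ := hdvd
  set t := 2 * (4 * (v ^ p - v) ^ 2) with ht
  have hpv : ¬ (p : ℤ) ∣ v.num := by
    intro h
    have h2 := Nat.dvd_gcd (Int.natCast_dvd.1 h) (Dvd.intro _ hn.symm)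
    rw [v.reduced] at h2
    exact hp.one_lt.ne' (Nat.dvd_one.1 h2)
  have hp1 : 1 < p := hp.one_lt
  obtain ⟨q, rfl⟩ : ∃ q, p = q + 1 := ⟨p - 1, by omega⟩
  have hprime : Prime ((q + 1 : ℕ) : ℤ) := Nat.prime_iff_prime_int.1 hp
  have heq : t.num * (v.den : ℤ) ^ (2 * (q + 1))
      = 8 * t.den * (v.num ^ (q + 1) - v.num * v.den ^ q) ^ 2 := by
    have ht0 : (t.den : ℚ) ≠ 0 := by simp
    have hv0 : (v.den : ℚ) ≠ 0 := by simp
    have h1 := t.num_div_den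
    have h2 : t * (v.den : ℚ) ^ (2 * (q + 1)) = 8 * (v.num ^ (q + 1) - v.num * v.den ^ q) ^ 2 := by
      have hvn : (v.num : ℚ) = v * v.den := by rw [Rat.mul_den_eq_num]
      rw [ht, hvn]
      ring
    have h3 : (t.num : ℚ) = t * t.den := by rw [Rat.mul_den_eq_num]
    have h4 : (t.num : ℚ) * (v.den : ℚ) ^ (2 * (q + 1))
      = 8 * t.den * (v.num ^ (q + 1) - v.num * v.den ^ q) ^ 2 := by
      rw [h3]
      linear_combination (t.den : ℚ) * h2
    exact_mod_cast h4
  have hd : ((q + 1 : ℕ) : ℤ) ^ (2 * (q + 1)) ∣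
      8 * (t.den * (v.num ^ (q + 1) - v.num * v.den ^ q) ^ 2) := by
    rw [← mul_assoc, ← heq, hn]
    push_cast
    rw [mul_pow]
    exact ⟨t.num * n ^ (2 * (q + 1)), by ring⟩
  have hcop : IsCoprime (((q + 1 : ℕ) : ℤ) ^ (2 * (q + 1)))
      (t.den * (v.num ^ (q + 1) - v.num * v.den ^ q) ^ 2) := by
    refine IsCoprime.pow_left ((Prime.coprime_iff_not_dvd hprime).2 ?_)
    intro h
    rcases hprime.dvd_or_dvd h with h | h
    · exact hX (Int.natCast_dvd_natCast.1 h)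
    · have h1 := hprime.dvd_of_dvd_pow h
      have h2 : ((q + 1 : ℕ) : ℤ) ∣ v.num * v.den ^ q := by
        rw [hn]
        exact Dvd.dvd.mul_left (dvd_pow (by push_cast; exact dvd_mul_right _ _) (by omega)) _
      exact hpv (hprime.dvd_of_dvd_pow ((dvd_sub_left h2).1 h1))
  have h8 := Int.le_of_dvd (by norm_num) (hcop.dvd_of_dvd_mul_right hd)
  have : (2 : ℤ) ^ 4 ≤ ((q + 1 : ℕ) : ℤ) ^ (2 * (q + 1)) := by
    calc (2 : ℤ) ^ 4 ≤ ((q + 1 : ℕ) : ℤ) ^ 4 := by gcongr; exact_mod_cast hp1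
      _ ≤ _ := pow_le_pow_right₀ (by exact_mod_cast hp1.le) (by omega)
  linarith

/-- An auxiliary prime `l` splits the problem: if `l` is a norm from `ℚ(√c)` and `M = 1 + c * K ^ 2`
is a norm from `ℚ(√(p l))`, substituting one equation into the other gives the quaternary
representation. The divisibilities give `M ≡ 1` modulo `p` and `8`. -/
theorem IsAuxPrime.isQuatTrace_natCast {p c : ℕ} (hp : p.Prime) (hc : IsAuxPrime p c) {K : ℕ}
    (hpK : p ∣ K) (h4 : 4 ∣ K) : IsQuatTrace p c K := by
  have : Fact p.Prime := ⟨hp⟩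
  have hcp : Fact c.Prime := ⟨hc.1⟩
  have hc5 := hc.2.1
  set M := 1 + c * K ^ 2 with hM
  have hM0 : M ≠ 0 := by omega
  have hM8 : M % 8 = 1 := by
    obtain ⟨k, rfl⟩ := h4
    have : M = 1 + 8 * (2 * c * k ^ 2) := by rw [hM]; ring
    omega
  have hMp : (p : ℤ) ∣ M - 1 := by
    rw [hM]
    push_cast
    obtain ⟨k, rfl⟩ := hpK
    exact ⟨c * p * k ^ 2, by push_cast; ring⟩
  have hMc : M ≡ 1 [MOD c] := by
    rw [hM, Nat.ModEq]
    simp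
  have hcopp : M.Coprime p := by
    rw [Nat.coprime_comm, hp.coprime_iff_not_dvd]
    intro h
    have hk : p ∣ c * K ^ 2 := (hpK.trans (dvd_pow_self K two_ne_zero)).mul_left c
    exact hp.one_lt.ne' (Nat.dvd_one.1 ((Nat.dvd_add_left hk).1 (hM ▸ h)))
  have hcopc : c.Coprime M := by
    rw [Nat.coprime_comm, Nat.Coprime, hMc.gcd_eq, Nat.gcd_one_left]
  have hneM : NeZero M := ⟨hM0⟩
  -- The prime `l` will satisfy `l ≡ 1 (mod c)` and `p * l ≡ 1 (mod M)`.
  obtain ⟨x, hxc, hxM⟩ := Nat.chineseRemainder hcopc 1 ((p : ZMod M)⁻¹).val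
  have hpinv : (p : ZMod M) * (p : ZMod M)⁻¹ = 1 := ZMod.coe_mul_inv_eq_one p hcopp.symm
  have hxM' : (p : ZMod M) * x = 1 := by
    rw [← ZMod.natCast_eq_natCast_iff] at hxM
    simpa [hxM] using hpinv
  have hx : x.Coprime (c * M) := by
    refine Nat.Coprime.mul_right ?_ ?_
    · rw [Nat.Coprime, hxc.gcd_eq, Nat.gcd_one_left]
    · rw [← ZMod.isUnit_iff_coprime]
      exact IsUnit.of_mul_eq_one _ ((mul_comm _ _).trans hxM')
  obtain ⟨l, hlgt, hl, hlx⟩ := Nat.forall_exists_prime_gt_and_modEq (p + c + 2)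
    (by simp [hM0, hc.1.ne_zero]) hx
  have hlF : Fact l.Prime := ⟨hl⟩
  have hlc : l ≡ 1 [MOD c] := (hlx.of_mul_right M).trans hxc
  have hplM : (p : ZMod M) * l = 1 := by
    have h1 := hlx.of_mul_left c
    rw [← ZMod.natCast_eq_natCast_iff] at h1
    rwa [h1]
  have hlodd : Odd l := hl.odd_of_ne_two (by omega)
  have hModd : Odd M := Nat.odd_iff.2 (by omega)
  have hl1 : ∃ a b : ℚ, a ^ 2 - c * b ^ 2 = l := by
    have hsq : IsSquare (c : ZMod l) := by
      rw [← ZMod.exists_sq_eq_prime_iff_of_mod_four_eq_one (by omega) (by omega)]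
      rw [← ZMod.natCast_eq_natCast_iff] at hlc
      rw [hlc]
      simp
    obtain ⟨r, hr⟩ := hsq
    refine exists_sq_sub_mul_sq_eq c l hc.1.pos hl.pos ((Nat.coprime_primes hc.1 hl).2 (by omega))
      r.val 1 ?_ ?_
    · rw [← ZMod.intCast_zmod_eq_zero_iff_dvd]
      push_cast
      simp [hr, sq]
    · rw [← ZMod.intCast_eq_intCast_iff_dvd_sub]
      rw [← ZMod.natCast_eq_natCast_iff] at hlc
      push_cast
      simpa using hlc
  -- Since `M ≡ 1 (mod 4)`, `(M/l) = (l/M)`, which equals `(p/M)` because `p * l ≡ 1 (mod M)`; and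
  -- `(p/M) = 1` by reciprocity, or by `M ≡ 1 (mod 8)` if `p = 2`.
  have hMl : IsSquare ((M : ℤ) : ZMod l) := by
    refine ZMod.isSquare_of_jacobiSym_eq_one ?_
    rw [jacobiSym.quadratic_reciprocity_one_mod_four (by omega) hlodd]
    have hJp : jacobiSym p M = 1 := by
      rcases eq_or_ne p 2 with rfl | hp2
      · rw [Nat.cast_ofNat, jacobiSym.at_two hModd, ZMod.χ₈_nat_eq_if_mod_eight, hM8]
        have : M % 2 ≠ 0 := by omega
        simp [this]
      · rw [← jacobiSym.quadratic_reciprocity_one_mod_four (by omega) (hp.odd_of_ne_two hp2),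
          jacobiSym.mod_left' (a₂ := 1) (Int.modEq_iff_dvd.2 hMp).symm, jacobiSym.one_left]
    have hJpl : jacobiSym (p * l) M = 1 := by
      rw [jacobiSym.mod_left' (a₂ := 1), jacobiSym.one_left]
      have : ((p * l : ℤ) : ZMod M) = (1 : ℤ) := by push_cast; exact hplM
      rwa [ZMod.intCast_eq_intCast_iff] at this
    rw [jacobiSym.mul_left, hJp, one_mul] at hJpl
    exact hJpl
  have hM1 : ∃ u v : ℚ, u ^ 2 - (p * l : ℕ) * v ^ 2 = M := by
    have hpl : p.Coprime l := (Nat.coprime_primes hp hl).2 (by omega)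
    obtain ⟨r, hr⟩ := hMl
    obtain ⟨t, htp, htl⟩ := Nat.chineseRemainder hpl 1 r.val
    refine exists_sq_sub_mul_sq_eq (p * l) M (Nat.mul_pos hp.pos hl.pos) (by omega) ?_ 1 t ?_ ?_
    · rw [Nat.coprime_comm]
      refine Nat.Coprime.mul_right hcopp ?_
      rw [Nat.coprime_comm, ← ZMod.isUnit_iff_coprime]
      exact IsUnit.of_mul_eq_one _ ((mul_comm _ _).trans hplM)
    · rw [← ZMod.intCast_eq_intCast_iff_dvd_sub]
      push_cast
      simpa using hplM
    · push_cast
      refine IsCoprime.mul_dvd (by exact_mod_cast hpl) ?_ ?_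
      · have h1 : (p : ℤ) ∣ t - 1 := by
          rw [← ZMod.natCast_eq_natCast_iff] at htp
          rw [← ZMod.intCast_zmod_eq_zero_iff_dvd]
          push_cast
          simp [htp]
        have h2 : (t : ℤ) ^ 2 - M = (t - 1) * (t + 1) - (M - 1) := by ring
        rw [h2]
        exact (h1.mul_right _).sub hMp
      · rw [← ZMod.natCast_eq_natCast_iff] at htl
        rw [← ZMod.intCast_zmod_eq_zero_iff_dvd]
        push_cast at hr ⊢
        rw [htl, hr]
        simp [sq]
  obtain ⟨a, b, hab⟩ := hl1
  obtain ⟨u, v, huv⟩ := hM1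
  refine ⟨u, a * v, b * v, ?_⟩
  have : (M : ℚ) = 1 + c * K ^ 2 := by rw [hM]; push_cast; ring
  rw [← this, ← huv]
  push_cast
  rw [← hab]
  ring

theorem IsAuxPrime.isQuatTrace_intCast {p c : ℕ} (hp : p.Prime) (hc : IsAuxPrime p c) (N : ℤ) :
    IsQuatTrace p c (4 * ((N : ℚ) ^ p - N) ^ 2) := by
  have : Fact p.Prime := ⟨hp⟩
  have hdvd : (p : ℤ) ∣ 4 * (N ^ p - N) ^ 2 := by
    refine Dvd.dvd.mul_left (dvd_pow ?_ two_ne_zero) _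
    rw [← ZMod.intCast_zmod_eq_zero_iff_dvd]
    push_cast
    simp
  have key := hc.isQuatTrace_natCast hp (K := (4 * (N ^ p - N) ^ 2).natAbs)
    (Int.natCast_dvd.1 hdvd) (Int.natCast_dvd.1 (dvd_mul_right _ _))
  have h : (((4 * (N ^ p - N) ^ 2).natAbs : ℕ) : ℚ) = 4 * ((N : ℚ) ^ p - N) ^ 2 := by
    rw [Nat.cast_natAbs, abs_of_nonneg (by positivity)]
    push_cast
    rfl
  rwa [h] at key

/-- The diophantine definition of the localization `ℤ_(p)` in `ℚ`. -/
theorem IsAuxPrime.not_dvd_den_iff {p c : ℕ} (hp : p.Prime) (hc : IsAuxPrime p c) (x : ℚ) :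
    ¬ p ∣ x.den ↔ ∃ y z : ℚ, x * (1 + p * z) = y ∧ IsQuatTrace p c (4 * (y ^ p - y) ^ 2) ∧
      IsQuatTrace p c (4 * (z ^ p - z) ^ 2) := by
  constructor
  · intro h
    have hcop : IsCoprime (x.den : ℤ) p :=
      Nat.isCoprime_iff_coprime.2 ((Nat.coprime_comm.1 (hp.coprime_iff_not_dvd.2 h)))
    obtain ⟨u, v, huv⟩ := hcop
    -- Bézout's `u * x.den + v * p = 1` makes `1 - p v` equal to `u * x.den`, so integers suffice
    -- for `y` and `z`.
    refine ⟨((u * x.num : ℤ) : ℚ), ((-v : ℤ) : ℚ), ?_, hc.isQuatTrace_intCast hp _,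
      hc.isQuatTrace_intCast hp _⟩
    have h1 : (u * x.den + v * p : ℚ) = 1 := by exact_mod_cast huv
    have h2 : (x.num : ℚ) = x * x.den := by rw [Rat.mul_den_eq_num]
    push_cast
    rw [h2]
    linear_combination (-x) * h1
  · rintro ⟨y, z, hxy, hy, hz⟩ hx
    have hy' := not_dvd_den_of_isQuatTrace hp hc hy
    have hz' := not_dvd_den_of_isQuatTrace hp hc hz
    have hprime : Prime (p : ℤ) := Nat.prime_iff_prime_int.1 hp
    have h2 : (x.num : ℚ) = x * x.den := by rw [Rat.mul_den_eq_num]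
    have h3 : (y.num : ℚ) = y * y.den := by rw [Rat.mul_den_eq_num]
    have h4 : (z.num : ℚ) = z * z.den := by rw [Rat.mul_den_eq_num]
    have heq : x.num * (z.den + p * z.num) * y.den = y.num * x.den * z.den := by
      have : (x.num * (z.den + p * z.num) * y.den : ℚ) = y.num * x.den * z.den := by
        rw [h2, h3, h4, ← hxy]
        ring
      exact_mod_cast this
    have hd : (p : ℤ) ∣ x.num * (z.den + p * z.num) * y.den := by
      rw [heq]
      exact ((Int.natCast_dvd_natCast.2 hx).mul_left _).mul_right _
    rcases hprime.dvd_or_dvd hd with h | h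
    · rcases hprime.dvd_or_dvd h with h | h
      · have h5 := Nat.dvd_gcd (Int.natCast_dvd.1 h) hx
        rw [x.reduced] at h5
        exact hp.one_lt.ne' (Nat.dvd_one.1 h5)
      · exact hz' (Int.natCast_dvd_natCast.1 ((Int.dvd_add_left (dvd_mul_right _ _)).1 h))
    · exact hy' (Int.natCast_dvd_natCast.1 h)

/-! ### Denominators in `ℤ[S⁻¹]` -/

theorem not_dvd_den_of_mem_invertedSubring {S : Set ℕ} (hS : ∀ q ∈ S, q.Prime) {p : ℕ}
    (hp : p.Prime) (hpS : p ∉ S) {x : ℚ} (hx : x ∈ invertedSubring S) : ¬ p ∣ x.den := by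
  have hprime : _root_.Prime p := hp.prime
  induction hx using Subring.closure_induction with
  | mem x hx =>
    obtain ⟨q, hq, rfl⟩ := hx
    have hq' := hS q hq
    simp only [Rat.inv_natCast_den, hq'.ne_zero, if_false]
    intro h
    exact hpS ((Nat.prime_dvd_prime_iff_eq hp hq').1 h ▸ hq)
  | zero => simpa using hp.one_lt.ne'
  | one => simpa using hp.one_lt.ne'
  | add x y _ _ hx hy =>
    exact fun h => (hprime.dvd_or_dvd (h.trans (Rat.add_den_dvd x y))).elim hx hy
  | neg x _ hx => simpa using hx
  | mul x y _ _ hx hy =>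
    exact fun h => (hprime.dvd_or_dvd (h.trans (Rat.mul_den_dvd x y))).elim hx hy

theorem inv_natCast_mem_invertedSubring {S : Set ℕ} {d : ℕ}
    (hd0 : d ≠ 0) (hd : ∀ p, p.Prime → p ∣ d → p ∈ S) : (d : ℚ)⁻¹ ∈ invertedSubring S := by
  induction d using Nat.recOnMul with
  | zero => exact absurd rfl hd0
  | one => simp
  | prime p hp => exact Subring.subset_closure ⟨p, hd p hp dvd_rfl, rfl⟩
  | mul a b ha hb =>
    rw [Nat.cast_mul, mul_inv]
    exact mul_mem (ha (left_ne_zero_of_mul hd0) fun p hp h => hd p hp (h.mul_right _))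
      (hb (right_ne_zero_of_mul hd0) fun p hp h => hd p hp (h.mul_left _))

theorem mem_invertedSubring_of_den {S : Set ℕ} {d : ℕ} (hd0 : d ≠ 0)
    (hd : ∀ p, p.Prime → p ∣ d → p ∈ S) (y : ℤ) : (y / d : ℚ) ∈ invertedSubring S := by
  rw [div_eq_mul_inv]
  exact mul_mem (intCast_mem _ y) (inv_natCast_mem_invertedSubring hd0 hd)

/-! ### Evaluation of polynomial codes -/

namespace HTP

/-- The value at `x` of the polynomial presented by a code. -/
def PolyCode.eval {R : Type*} [CommRing R] (x : ℕ → R) (L : PolyCode) : R :=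
  (L.map fun t => (t.1 : R) * (t.2.map x).prod).sum

theorem PolyCode.aeval_toPoly {R : Type*} [CommRing R] (x : ℕ → R) (L : PolyCode) :
    MvPolynomial.aeval x L.toPoly = L.eval x := by
  simp only [PolyCode.toPoly, PolyCode.eval, map_list_sum, List.map_map]
  congr 1
  refine List.map_congr_left fun t _ => ?_
  simp [map_list_prod, Function.comp_def]

/-- The variables occurring in a code. -/
def PolyCode.vars (L : PolyCode) : List ℕ := L.flatMap Prod.snd

theorem PolyCode.eval_congr {R : Type*} [CommRing R] {x y : ℕ → R} {L : PolyCode}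
    (h : ∀ i ∈ L.vars, x i = y i) : L.eval x = L.eval y := by
  unfold PolyCode.eval
  congr 1
  refine List.map_congr_left fun t ht => ?_
  congr 2
  exact List.map_congr_left fun i hi => h i (List.mem_flatMap.2 ⟨t, ht, hi⟩)

theorem mem_hilbertTenth {R : Type*} [CommRing R] {e : ℕ} :
    e ∈ hilbertTenth R ↔ ∃ x : ℕ → R, (Denumerable.ofNat PolyCode e).eval x = 0 := by
  simp [hilbertTenth, polyEnum, PolyCode.aeval_toPoly]

theorem mem_hilbertTenth_subring {A : Subring ℚ} {e : ℕ} :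
    e ∈ hilbertTenth A ↔
      ∃ x : ℕ → ℚ, (∀ i, x i ∈ A) ∧ (Denumerable.ofNat PolyCode e).eval x = 0 := by
  have h : ∀ (x : ℕ → A) (L : PolyCode), L.eval (fun i => (x i : ℚ)) = (L.eval x : A) := by
    intro x L
    simp [PolyCode.eval, Function.comp_def]
  rw [mem_hilbertTenth]
  constructor
  · rintro ⟨x, hx⟩
    exact ⟨fun i => x i, fun i => (x i).2, by rw [h, hx]; rfl⟩
  · rintro ⟨x, hxA, hx⟩
    exact ⟨fun i => ⟨x i, hxA i⟩, Subtype.ext ((h _ _).symm.trans hx)⟩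

end HTP

/-! ### Primitive recursive arithmetic and bounded quantifiers -/

namespace Primrec

variable {α β : Type*} [Primcodable α] [Primcodable β]

/-- Makes the coding of `ℤ` explicit, so that integer operations reduce to natural ones on positive
and negative parts. -/
theorem int_ofNat_eq (n : ℕ) :
    Denumerable.ofNat ℤ n = if n % 2 = 0 then ((n / 2 : ℕ) : ℤ) else -((n / 2 + 1 : ℕ) : ℤ) := by
  have h : ∀ z : ℤ, Denumerable.ofNat ℤ (Equiv.intEquivNat z) = z := fun z =>
    Denumerable.ofNat_encode z
  split_ifs with hn
  · rw [← h (n / 2 : ℕ)]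
    congr 1
    change n = 2 * (n / 2)
    omega
  · rw [← h (-((n / 2 + 1 : ℕ) : ℤ))]
    congr 1
    change n = 2 * (n / 2) + 1
    omega

theorem int_toNat : Primrec Int.toNat := by
  rw [Primrec.ofNat_iff]
  refine Primrec.of_eq (f := fun n => if n % 2 = 0 then n / 2 else 0) ?_ ?_
  · exact Primrec.ite (Primrec.eq.comp (nat_mod.comp .id (.const 2)) (.const 0))
      (nat_div.comp .id (.const 2)) (.const 0)
  · intro n
    rw [int_ofNat_eq]
    split_ifs <;> omega

theorem int_toNat_neg : Primrec fun z : ℤ => (-z).toNat := by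
  rw [Primrec.ofNat_iff]
  refine Primrec.of_eq (f := fun n => if n % 2 = 0 then 0 else n / 2 + 1) ?_ ?_
  · exact Primrec.ite (Primrec.eq.comp (nat_mod.comp .id (.const 2)) (.const 0))
      (.const 0) (succ.comp (nat_div.comp .id (.const 2)))
  · intro n
    rw [int_ofNat_eq]
    split_ifs <;> omega

theorem int_sub_natCast : Primrec₂ fun a b : ℕ => (a : ℤ) - b := by
  refine Primrec.of_eq (f := fun v : ℕ × ℕ => Denumerable.ofNat ℤ
    (if v.2 ≤ v.1 then 2 * (v.1 - v.2) else 2 * (v.2 - v.1) - 1)) ?_ ?_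
  · refine (Primrec.ofNat ℤ).comp (Primrec.ite (nat_le.comp snd fst)
      (nat_double.comp (nat_sub.comp fst snd))
      (nat_sub.comp (nat_double.comp (nat_sub.comp snd fst)) (.const 1)))
  · rintro ⟨a, b⟩
    rw [int_ofNat_eq]
    dsimp only
    split_ifs <;> omega

theorem int_natCast : Primrec fun n : ℕ => (n : ℤ) :=
  (int_sub_natCast.comp .id (.const 0)).of_eq fun n => by simp

theorem int_add : Primrec₂ ((· + ·) : ℤ → ℤ → ℤ) := by
  refine Primrec.of_eq (f := fun v : ℤ × ℤ =>
    ((v.1.toNat + v.2.toNat : ℕ) : ℤ) - (((-v.1).toNat + (-v.2).toNat : ℕ) : ℤ)) ?_ ?_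
  · exact int_sub_natCast.comp
      (nat_add.comp (int_toNat.comp fst) (int_toNat.comp snd))
      (nat_add.comp (int_toNat_neg.comp fst) (int_toNat_neg.comp snd))
  · rintro ⟨a, b⟩
    dsimp only
    omega

theorem int_mul : Primrec₂ ((· * ·) : ℤ → ℤ → ℤ) := by
  refine Primrec.of_eq (f := fun v : ℤ × ℤ =>
    ((v.1.toNat * v.2.toNat + (-v.1).toNat * (-v.2).toNat : ℕ) : ℤ) -
      ((v.1.toNat * (-v.2).toNat + (-v.1).toNat * v.2.toNat : ℕ) : ℤ)) ?_ ?_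
  · have h1 : Primrec fun v : ℤ × ℤ => v.1.toNat := int_toNat.comp fst
    have h2 : Primrec fun v : ℤ × ℤ => v.2.toNat := int_toNat.comp snd
    have h3 : Primrec fun v : ℤ × ℤ => (-v.1).toNat := int_toNat_neg.comp fst
    have h4 : Primrec fun v : ℤ × ℤ => (-v.2).toNat := int_toNat_neg.comp snd
    exact int_sub_natCast.comp (nat_add.comp (nat_mul.comp h1 h2) (nat_mul.comp h3 h4))
      (nat_add.comp (nat_mul.comp h1 h4) (nat_mul.comp h3 h2))
  · rintro ⟨a, b⟩
    have h : ∀ z : ℤ, z = (z.toNat : ℤ) - (-z).toNat := fun z => by omega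
    dsimp only
    push_cast
    conv_rhs => rw [h a, h b]
    ring

theorem pow_of_mul {M : Type*} [Monoid M] [Primcodable M] (h : Primrec₂ ((· * ·) : M → M → M)) :
    Primrec₂ ((· ^ ·) : M → ℕ → M) := by
  refine (Primrec.nat_rec' (f := fun v : M × ℕ => v.2) (g := fun _ => 1)
    (h := fun v w => w.2 * v.1) snd (.const 1) ?_).of_eq ?_
  · exact (h.comp (snd.comp snd) (fst.comp fst)).to₂
  · rintro ⟨z, n⟩
    induction n with
    | zero => simp
    | succ n ih =>
      simp only at ih ⊢
      rw [ih, pow_succ]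

theorem list_prod {M : Type*} [Monoid M] [Primcodable M] (h : Primrec₂ ((· * ·) : M → M → M)) :
    Primrec (List.prod : List M → M) :=
  (Primrec.list_foldr .id (.const 1) (h.comp (fst.comp snd) (snd.comp snd)).to₂).of_eq
    fun l => by simp [List.prod_eq_foldr]

theorem list_sum {M : Type*} [AddMonoid M] [Primcodable M]
    (h : Primrec₂ ((· + ·) : M → M → M)) : Primrec (List.sum : List M → M) :=
  (Primrec.list_foldr .id (.const 0) (h.comp (fst.comp snd) (snd.comp snd)).to₂).of_eq
    fun l => by simp [List.sum_eq_foldr]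

theorem list_replicate : Primrec₂ fun (n : ℕ) (a : β) => List.replicate n a :=
  Primrec.of_eq (Primrec.list_map (Primrec.list_range.comp fst) (snd.comp fst).to₂) fun n => by
    simp

theorem filter_list {f : α → List β} {R : α → β → Prop} [∀ a, DecidablePred (R a)]
    (hf : Primrec f) (hR : PrimrecRel R) : Primrec fun a => (f a).filter (R a ·) :=
  (PrimrecRel.listFilter (R := fun b a => R a b) hR.swap).comp hf .id

theorem forall_mem {f : α → List β} {R : α → β → Prop}
    (hf : Primrec f) (hR : PrimrecRel R) : PrimrecPred fun a => ∀ b ∈ f a, R a b :=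
  (PrimrecRel.forall_mem_list (R := fun b a => R a b) hR.swap).comp hf .id

theorem exists_mem {f : α → List β} {R : α → β → Prop}
    (hf : Primrec f) (hR : PrimrecRel R) : PrimrecPred fun a => ∃ b ∈ f a, R a b :=
  (PrimrecRel.exists_mem_list (R := fun b a => R a b) hR.swap).comp hf .id

theorem nat_dvd : PrimrecRel ((· ∣ ·) : ℕ → ℕ → Prop) :=
  (Primrec.eq.comp (nat_mod.comp snd fst) (.const 0)).of_eq fun _ =>
    (Nat.dvd_iff_mod_eq_zero).symm

theorem nat_prime : PrimrecPred Nat.Prime := by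
  refine PrimrecPred.of_eq (p := fun n => 2 ≤ n ∧ ∀ m ∈ List.range n, m ∣ n → m = 1) ?_ ?_
  · refine (nat_le.comp (.const 2) .id).and (forall_mem list_range ?_)
    refine PrimrecPred.of_eq (p := fun v : ℕ × ℕ => ¬ v.2 ∣ v.1 ∨ v.2 = 1)
      ((nat_dvd.comp snd fst).not.or (Primrec.eq.comp snd (.const 1))) fun v => ?_
    tauto
  · intro n
    simp [Nat.prime_def_lt]

end Primrec

instance (p c : ℕ) : Decidable (IsAuxPrime p c) :=
  inferInstanceAs (Decidable (_ ∧ _ ∧ _))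

theorem primrecRel_isAuxPrime : PrimrecRel IsAuxPrime := by
  refine PrimrecPred.of_eq (p := fun v : ℕ × ℕ => v.2.Prime ∧ v.2 % 8 = 5 ∧
    ∀ y ∈ List.range v.2, y * y % v.2 ≠ v.1 % v.2) ?_ fun v => by simp [IsAuxPrime]
  refine (Primrec.nat_prime.comp .snd).and ((Primrec.eq.comp (Primrec.nat_mod.comp .snd (.const 8))
    (.const 5)).and (Primrec.forall_mem (Primrec.list_range.comp .snd) ?_))
  refine (Primrec.eq.comp ?_ ?_).not
  · exact Primrec.nat_mod.comp (Primrec.nat_mul.comp .snd .snd) (Primrec.snd.comp .fst)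
  · exact Primrec.nat_mod.comp (Primrec.fst.comp .fst) (Primrec.snd.comp .fst)

/-! ### Encoding integrality conditions in one polynomial -/

namespace HTP.PolyCode

variable {R : Type*} [CommRing R]

/-- A code for the product of two polynomials. -/
def mul (L M : PolyCode) : PolyCode :=
  L.flatMap fun t => M.map fun s => (t.1 * s.1, t.2 ++ s.2)

/-- A code for the square of a polynomial. -/
def sq (L : PolyCode) : PolyCode := mul L L

/-- A code for the polynomial obtained by replacing each variable `X_i` by `X_{9i}`. -/
def spread (L : PolyCode) : PolyCode := L.map fun t => (t.1, t.2.map (9 * ·))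

/-- A code for `X_x (1 + p X_z) - X_y`. -/
def quotCode (p x y z : ℕ) : PolyCode := [(1, [x]), ((p : ℤ), [x, z]), (-1, [y])]

/-- A code for `X_y ^ p - X_y`. -/
def fermatCode (p y : ℕ) : PolyCode := [(1, List.replicate p y), (-1, [y])]

/-- A code for the equation defining `IsQuatTrace p c (4 * (X_y ^ p - X_y) ^ 2)`. -/
def quatCode (p c y u a b : ℕ) : PolyCode :=
  mul [(16 * (c : ℤ), [])] (sq (sq (fermatCode p y))) ++
    [(1, []), (-1, [u, u]), ((p : ℤ), [a, a]), (-1 * ((p : ℤ) * c), [b, b])]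

/-- A code for the equation, with auxiliary variables `X_{9t+1}, …, X_{9t+8}`, which says that `p`
does not divide the denominator of `X_{9j}`. -/
def integralCode (j p c t : ℕ) : PolyCode :=
  sq (quotCode p (9 * j) (9 * t + 1) (9 * t + 2)) ++
    (sq (quatCode p c (9 * t + 1) (9 * t + 3) (9 * t + 4) (9 * t + 5)) ++
      sq (quatCode p c (9 * t + 2) (9 * t + 6) (9 * t + 7) (9 * t + 8)))

/-- A code for a polynomial having a root in `ℚ` if and only if the one presented by `L` has a root
in `ℚ` whose coordinates have no denominator divisible by one of the primes `p` for `(p, c)`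
in `Q`. -/
def localCode (L : PolyCode) (Q : List (ℕ × ℕ)) : PolyCode :=
  sq (spread L) ++
    L.vars.flatMap fun j => Q.flatMap fun q =>
      -- Injectivity of pairing gives each triple `(j, p, c)` its own block of auxiliary variables;
      -- the multiples of `9` remain for the original ones.
      integralCode j q.1 q.2 (Nat.pair j (Nat.pair q.1 q.2))

@[simp]
theorem eval_nil (x : ℕ → R) : eval x [] = 0 := rfl

@[simp]
theorem eval_cons (x : ℕ → R) (t : ℤ × List ℕ) (L : PolyCode) :
    eval x (t :: L) = t.1 * (t.2.map x).prod + eval x L := rfl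

@[simp]
theorem eval_append (x : ℕ → R) (L M : PolyCode) : eval x (L ++ M) = eval x L + eval x M := by
  simp [eval]

theorem eval_flatMap {β : Type*} (x : ℕ → R) (l : List β) (f : β → PolyCode) :
    eval x (l.flatMap f) = (l.map fun b => eval x (f b)).sum := by
  induction l with
  | nil => rfl
  | cons b l ih => simp [ih]

@[simp]
theorem eval_mul (x : ℕ → R) (L M : PolyCode) : eval x (mul L M) = eval x L * eval x M := by
  have h : ∀ t : ℤ × List ℕ, eval x (M.map fun s => (t.1 * s.1, t.2 ++ s.2))
      = t.1 * (t.2.map x).prod * eval x M := by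
    intro t
    induction M with
    | nil => simp
    | cons s M ih =>
      simp only [List.map_cons, eval_cons, ih, List.map_append, List.prod_append]
      push_cast
      ring
  rw [mul, eval_flatMap]
  simp only [h]
  rw [List.sum_map_mul_right]
  rfl

@[simp]
theorem eval_sq (x : ℕ → R) (L : PolyCode) : eval x (sq L) = eval x L ^ 2 := by
  rw [sq, eval_mul, _root_.sq]

@[simp]
theorem eval_spread (x : ℕ → R) (L : PolyCode) :
    eval x (spread L) = eval (fun i => x (9 * i)) L := by
  simp [eval, spread, Function.comp_def]

@[simp]
theorem eval_quotCode (x : ℕ → R) (p i j k : ℕ) :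
    eval x (quotCode p i j k) = x i * (1 + p * x k) - x j := by
  simp [quotCode]
  ring

@[simp]
theorem eval_quatCode (x : ℕ → R) (p c y u a b : ℕ) :
    eval x (quatCode p c y u a b) = 1 + c * (4 * (x y ^ p - x y) ^ 2) ^ 2 -
      (x u ^ 2 - p * (x a ^ 2 - c * x b ^ 2)) := by
  simp [quatCode, fermatCode]
  ring

theorem eval_integralCode_eq_zero {x : ℕ → ℚ} {j p c t : ℕ} :
    eval x (integralCode j p c t) = 0 ↔
      x (9 * j) * (1 + p * x (9 * t + 2)) = x (9 * t + 1) ∧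
      1 + c * (4 * (x (9 * t + 1) ^ p - x (9 * t + 1)) ^ 2) ^ 2 =
        x (9 * t + 3) ^ 2 - p * (x (9 * t + 4) ^ 2 - c * x (9 * t + 5) ^ 2) ∧
      1 + c * (4 * (x (9 * t + 2) ^ p - x (9 * t + 2)) ^ 2) ^ 2 =
        x (9 * t + 6) ^ 2 - p * (x (9 * t + 7) ^ 2 - c * x (9 * t + 8) ^ 2) := by
  simp only [integralCode, eval_append, eval_sq, eval_quotCode, eval_quatCode]
  rw [add_eq_zero_iff_of_nonneg (sq_nonneg _) (by positivity),
    add_eq_zero_iff_of_nonneg (sq_nonneg _) (sq_nonneg _)]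
  simp only [sq_eq_zero_iff, sub_eq_zero]

theorem eval_integralCode_nonneg (x : ℕ → ℚ) (j p c t : ℕ) :
    0 ≤ eval x (integralCode j p c t) := by
  simp only [integralCode, eval_append, eval_sq]
  positivity

theorem eval_localCode_eq_zero {x : ℕ → ℚ} {L : PolyCode} {Q : List (ℕ × ℕ)} :
    eval x (localCode L Q) = 0 ↔ eval (fun i => x (9 * i)) L = 0 ∧ ∀ j ∈ L.vars, ∀ q ∈ Q,
      eval x (integralCode j q.1 q.2 (Nat.pair j (Nat.pair q.1 q.2))) = 0 := by
  have h0 : ∀ {l : List ℚ}, (∀ a ∈ l, 0 ≤ a) → (l.sum = 0 ↔ ∀ a ∈ l, a = 0) := by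
    intro l hl
    refine ⟨fun h a ha => ?_, List.sum_eq_zero⟩
    exact le_antisymm (h ▸ List.single_le_sum hl a ha) (hl a ha)
  have h1 : ∀ j, 0 ≤ (Q.map fun q =>
      eval x (integralCode j q.1 q.2 (Nat.pair j (Nat.pair q.1 q.2)))).sum := by
    intro j
    refine List.sum_nonneg ?_
    simp only [List.mem_map]
    rintro _ ⟨q, -, rfl⟩
    exact eval_integralCode_nonneg _ _ _ _ _
  rw [localCode, eval_append, eval_sq, eval_spread, add_eq_zero_iff_of_nonneg (sq_nonneg _),
    sq_eq_zero_iff, eval_flatMap]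
  · refine and_congr_right fun _ => ?_
    simp only [eval_flatMap]
    rw [h0]
    · simp only [List.mem_map, forall_exists_index, and_imp, forall_apply_eq_imp_iff₂]
      refine forall₂_congr fun j _ => ?_
      rw [h0]
      · simp only [List.mem_map, forall_exists_index, and_imp, forall_apply_eq_imp_iff₂]
      · simp only [List.mem_map]
        rintro _ ⟨q, -, rfl⟩
        exact eval_integralCode_nonneg _ _ _ _ _
    · simp only [List.mem_map]
      rintro _ ⟨j, -, rfl⟩
      exact h1 j
  · rw [eval_flatMap]
    refine List.sum_nonneg ?_
    simp only [List.mem_map]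
    rintro _ ⟨j, -, rfl⟩
    rw [eval_flatMap]
    exact h1 j

theorem exists_eval_localCode_eq_zero {L : PolyCode} {Q : List (ℕ × ℕ)}
    (hQ : ∀ q ∈ Q, q.1.Prime ∧ IsAuxPrime q.1 q.2) :
    (∃ x : ℕ → ℚ, eval x (localCode L Q) = 0) ↔
      ∃ x : ℕ → ℚ, eval x L = 0 ∧ ∀ j ∈ L.vars, ∀ q ∈ Q, ¬ q.1 ∣ (x j).den := by
  constructor
  · rintro ⟨x, hx⟩
    rw [eval_localCode_eq_zero] at hx
    refine ⟨_, hx.1, fun j hj q hq => ?_⟩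
    have h := eval_integralCode_eq_zero.1 (hx.2 j hj q hq)
    rw [(hQ q hq).2.not_dvd_den_iff (hQ q hq).1]
    exact ⟨_, _, h.1, ⟨_, _, _, h.2.1⟩, ⟨_, _, _, h.2.2⟩⟩
  · rintro ⟨x, hx, hden⟩
    -- The nine values in block `t`: the original coordinate `x t`, then the witnesses if `t` codes
    -- a relevant triple.
    have key : ∀ t : ℕ, ∃ w : ℕ → ℚ, w 0 = x t ∧ ∀ j ∈ L.vars, ∀ q ∈ Q,
        t = Nat.pair j (Nat.pair q.1 q.2) →
        x j * (1 + q.1 * w 2) = w 1 ∧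
        1 + q.2 * (4 * (w 1 ^ q.1 - w 1) ^ 2) ^ 2 = w 3 ^ 2 - q.1 * (w 4 ^ 2 - q.2 * w 5 ^ 2) ∧
        1 + q.2 * (4 * (w 2 ^ q.1 - w 2) ^ 2) ^ 2 = w 6 ^ 2 - q.1 * (w 7 ^ 2 - q.2 * w 8 ^ 2) := by
      intro t
      by_cases ht : ∃ j ∈ L.vars, ∃ q ∈ Q, t = Nat.pair j (Nat.pair q.1 q.2)
      · obtain ⟨j, hj, q, hq, rfl⟩ := ht
        have h := hden j hj q hq
        rw [(hQ q hq).2.not_dvd_den_iff (hQ q hq).1] at h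
        obtain ⟨y, z, h1, ⟨u, a, b, h2⟩, ⟨u', a', b', h3⟩⟩ := h
        refine ⟨fun k => [x (Nat.pair j (Nat.pair q.1 q.2)), y, z, u, a, b, u', a', b'].getD k 0,
          rfl, ?_⟩
        intro j' _ q' _ heq
        rw [Nat.pair_eq_pair, Nat.pair_eq_pair] at heq
        obtain ⟨rfl, h4, h5⟩ := heq
        rw [← h4, ← h5]
        exact ⟨h1, h2, h3⟩
      · refine ⟨fun _ => x t, rfl, fun j hj q hq h => absurd ⟨j, hj, q, hq, h⟩ ht⟩
    choose w hw0 hw using key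
    have hmod : ∀ t k, k < 9 → w ((9 * t + k) / 9) ((9 * t + k) % 9) = w t k := by
      intro t k hk
      rw [show (9 * t + k) / 9 = t by omega, show (9 * t + k) % 9 = k by omega]
    have hmod0 : ∀ t, w ((9 * t) / 9) ((9 * t) % 9) = x t := by
      intro t
      rw [← hw0]
      exact hmod t 0 (by norm_num)
    refine ⟨fun n => w (n / 9) (n % 9), eval_localCode_eq_zero.2 ⟨?_, fun j hj q hq => ?_⟩⟩
    · simpa only [hmod0] using hx
    · rw [eval_integralCode_eq_zero]
      simp only [hmod0, hmod _ 1 (by norm_num), hmod _ 2 (by norm_num), hmod _ 3 (by norm_num),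
        hmod _ 4 (by norm_num), hmod _ 5 (by norm_num), hmod _ 6 (by norm_num),
        hmod _ 7 (by norm_num), hmod _ 8 (by norm_num)]
      exact hw _ j hj q hq rfl

section Primrec

open Primrec

theorem primrec_mul : Primrec₂ mul := by
  refine (list_flatMap (fst (α := PolyCode) (β := PolyCode)) (g := fun v t => v.2.map fun s =>
    (t.1 * s.1, t.2 ++ s.2)) ?_).to₂
  refine (list_map (snd.comp fst) (g := fun (v : (PolyCode × PolyCode) × (ℤ × List ℕ)) s =>
    (v.2.1 * s.1, v.2.2 ++ s.2)) ?_).to₂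
  exact (Primrec.pair (int_mul.comp (fst.comp (snd.comp fst)) (fst.comp snd))
    (list_append.comp (snd.comp (snd.comp fst)) (snd.comp snd))).to₂

theorem primrec_sq : Primrec sq := primrec_mul.comp .id .id

theorem primrec_spread : Primrec spread := by
  have h : Primrec fun v : PolyCode × (ℤ × List ℕ) => (v.2.1, v.2.2.map (9 * ·)) :=
    Primrec.pair (fst.comp snd)
      (list_map (snd.comp snd) (nat_mul.comp (.const 9) snd).to₂)
  exact list_map .id h.to₂

theorem primrec_vars : Primrec vars := list_flatMap .id (snd.comp snd).to₂

variable {α : Type*} [Primcodable α] {p c x y z u a b : α → ℕ}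

theorem primrec_term {k : α → ℤ} {l : α → List ℕ} {L : α → PolyCode}
    (hk : Primrec k) (hl : Primrec l) (hL : Primrec L) :
    Primrec fun v => ((k v, l v) :: L v : PolyCode) :=
  list_cons.comp (Primrec.pair hk hl) hL

theorem primrec_singleton (hx : Primrec x) : Primrec fun v => [x v] :=
  list_cons.comp hx (.const [])

theorem primrec_doubleton (hx : Primrec x) (hy : Primrec y) : Primrec fun v => [x v, y v] :=
  list_cons.comp hx (primrec_singleton hy)

theorem primrec_quotCode (hp : Primrec p) (hx : Primrec x) (hy : Primrec y) (hz : Primrec z) :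
    Primrec fun v => quotCode (p v) (x v) (y v) (z v) :=
  primrec_term (.const 1) (primrec_singleton hx) <|
    primrec_term (int_natCast.comp hp) (primrec_doubleton hx hz) <|
    primrec_term (.const (-1)) (primrec_singleton hy) (.const [])

theorem primrec_quatCode (hp : Primrec p) (hc : Primrec c) (hy : Primrec y) (hu : Primrec u)
    (ha : Primrec a) (hb : Primrec b) :
    Primrec fun v => quatCode (p v) (c v) (y v) (u v) (a v) (b v) := by
  have hf : Primrec fun v => fermatCode (p v) (y v) :=
    primrec_term (.const 1) (list_replicate.comp hp hy) <|
      primrec_term (.const (-1)) (primrec_singleton hy) (.const [])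
  refine list_append.comp (primrec_mul.comp ?_ (primrec_sq.comp (primrec_sq.comp hf))) ?_
  · exact primrec_term (int_mul.comp (.const 16) (int_natCast.comp hc)) (.const []) (.const [])
  · exact primrec_term (.const 1) (.const []) <|
      primrec_term (.const (-1)) (primrec_doubleton hu hu) <|
      primrec_term (int_natCast.comp hp) (primrec_doubleton ha ha) <|
      primrec_term (int_mul.comp (.const (-1))
        (int_mul.comp (int_natCast.comp hp) (int_natCast.comp hc)))
        (primrec_doubleton hb hb) (.const [])

theorem primrec_integralCode {j t : α → ℕ} (hj : Primrec j) (hp : Primrec p) (hc : Primrec c)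
    (ht : Primrec t) : Primrec fun v => integralCode (j v) (p v) (c v) (t v) := by
  have h : ∀ k : ℕ, Primrec fun v => 9 * t v + k := fun k =>
    nat_add.comp (nat_mul.comp (.const 9) ht) (.const k)
  exact list_append.comp
    (primrec_sq.comp (primrec_quotCode hp (nat_mul.comp (.const 9) hj) (h 1) (h 2)))
    (list_append.comp (primrec_sq.comp (primrec_quatCode hp hc (h 1) (h 3) (h 4) (h 5)))
      (primrec_sq.comp (primrec_quatCode hp hc (h 2) (h 6) (h 7) (h 8))))

theorem primrec_localCode : Primrec₂ localCode := by
  refine list_append.comp (primrec_sq.comp (primrec_spread.comp fst)) ?_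
  refine list_flatMap (primrec_vars.comp fst) ?_
  refine list_flatMap (snd.comp fst) ?_
  have hp : Primrec fun v : ((PolyCode × List (ℕ × ℕ)) × ℕ) × (ℕ × ℕ) => v.2.1 := fst.comp snd
  have hc : Primrec fun v : ((PolyCode × List (ℕ × ℕ)) × ℕ) × (ℕ × ℕ) => v.2.2 := snd.comp snd
  have hj : Primrec fun v : ((PolyCode × List (ℕ × ℕ)) × ℕ) × (ℕ × ℕ) => v.1.2 := snd.comp fst
  exact primrec_integralCode hj hp hc (Primrec₂.natPair.comp hj (Primrec₂.natPair.comp hp hc))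

end Primrec

end HTP.PolyCode

/-! ### Integer verification of rational roots -/

namespace HTP.PolyCode

/-- The value at `(y_i / d)_i`, cleared of denominators, of the polynomial presented by a code. -/
def homEval (L : PolyCode) (d : ℕ) (ys : List ℤ) : ℤ :=
  (L.map fun t => t.1 * (t.2.map (ys.getD · 0)).prod *
    (d : ℤ) ^ (L.vars.length - t.2.length)).sum

/-- Guarantees that the exponent subtraction in `homEval` is not truncated. -/
theorem length_le_length_vars {L : PolyCode} {t : ℤ × List ℕ} (ht : t ∈ L) :
    t.2.length ≤ L.vars.length := by
  rw [vars, List.length_flatMap]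
  exact List.le_sum_of_mem (List.mem_map.2 ⟨t, ht, rfl⟩)

theorem cast_homEval (L : PolyCode) {d : ℕ} (hd : d ≠ 0) (ys : List ℤ) :
    (homEval L d ys : ℚ) = d ^ L.vars.length * eval (fun i => (ys.getD i 0 : ℚ) / d) L := by
  have hd' : (d : ℚ) ≠ 0 := by exact_mod_cast hd
  have hprod : ∀ l : List ℕ, (l.map fun i => (ys.getD i 0 : ℚ) / d).prod * d ^ l.length
      = ((l.map (ys.getD · 0)).prod : ℤ) := by
    intro l
    induction l with
    | nil => simp
    | cons i l ih =>
      simp only [List.map_cons, List.prod_cons, List.length_cons, pow_succ]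
      rw [Int.cast_mul, ← ih]
      field_simp
  rw [homEval, eval, ← List.sum_map_mul_left, Int.cast_list_sum, List.map_map]
  congr 1
  refine List.map_congr_left fun t ht => ?_
  rw [← Nat.sub_add_cancel (length_le_length_vars ht), pow_add]
  simp only [Function.comp_apply, Int.cast_mul, ← hprod, Int.cast_pow, Int.cast_natCast,
    Nat.sub_add_cancel (length_le_length_vars ht)]
  ring

theorem homEval_eq_zero_iff (L : PolyCode) {d : ℕ} (hd : d ≠ 0) (ys : List ℤ) :
    homEval L d ys = 0 ↔ eval (fun i => (ys.getD i 0 : ℚ) / d) L = 0 := by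
  have hd' : (d : ℚ) ≠ 0 := by exact_mod_cast hd
  rw [← Int.cast_eq_zero (α := ℚ), cast_homEval L hd]
  simp [hd']

theorem exists_homEval_eq_zero {L : PolyCode} {F : List ℕ} (hF : ∀ p ∈ F, p.Prime) {x : ℕ → ℚ}
    (hx : eval x L = 0) (hden : ∀ j ∈ L.vars, ∀ p ∈ F, ¬ p ∣ (x j).den) :
    ∃ d : ℕ, d ≠ 0 ∧ (∀ p ∈ F, ¬ p ∣ d) ∧ ∃ ys, homEval L d ys = 0 := by
  set d := (L.vars.map fun j => (x j).den).prod with hd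
  have hd0 : d ≠ 0 := by
    rw [hd, Ne, List.prod_eq_zero_iff]
    simp
  have hd' : (d : ℚ) ≠ 0 := by exact_mod_cast hd0
  refine ⟨d, hd0, fun p hp h => ?_,
    -- The sum of the variable indices bounds each of them, so the list reaches every variable of
    -- `L`.
    (List.range (L.vars.sum + 1)).map fun j => (x j).num * (d / (x j).den : ℕ), ?_⟩
  · rw [hd, (hF p hp).prime.dvd_prod_iff] at h
    obtain ⟨a, ha, hpa⟩ := h
    obtain ⟨j, hj, rfl⟩ := List.mem_map.1 ha
    exact hden j hj p hp hpa
  · rw [homEval_eq_zero_iff L hd0, ← hx]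
    refine eval_congr fun j hj => ?_
    have hj' : j < L.vars.sum + 1 := Nat.lt_succ_of_le (List.le_sum_of_mem hj)
    have hdvd : (x j).den ∣ d := List.dvd_prod (List.mem_map.2 ⟨j, hj, rfl⟩)
    have h0 : ((x j).den : ℚ) ≠ 0 := by simp
    rw [List.getD_eq_getElem?_getD, List.getElem?_map, List.getElem?_range hj']
    simp only [Option.map_some, Option.getD_some]
    rw [Int.cast_mul, Int.cast_natCast, Nat.cast_div hdvd h0]
    rw [← Rat.mul_den_eq_num (x j)]
    field_simp

open Primrec in
theorem primrec_homEval : Primrec fun v : PolyCode × (ℕ × List ℤ) => homEval v.1 v.2.1 v.2.2 := by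
  refine (list_sum int_add).comp (list_map fst ?_)
  refine int_mul.comp (int_mul.comp (fst.comp snd) ?_) ?_
  · refine (list_prod int_mul).comp (list_map (snd.comp snd) ?_)
    exact (list_getD 0).comp (snd.comp (snd.comp (fst.comp fst))) snd
  · exact (pow_of_mul int_mul).comp (int_natCast.comp (fst.comp (snd.comp fst)))
      (nat_sub.comp (list_length.comp (primrec_vars.comp (fst.comp fst)))
        (list_length.comp (snd.comp snd)))

end HTP.PolyCode

/-! ### Recursion with one oracle question per step -/

namespace Nat.RecursiveIn

variable {O : Set (ℕ →. ℕ)}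

theorem comp_total {f h : ℕ → ℕ} (hf : Nat.RecursiveIn O f) (hh : Nat.RecursiveIn O h) :
    Nat.RecursiveIn O (fun n => f (h n) : ℕ → ℕ) :=
  (hf.comp hh).of_eq_tot fun _ => Part.mem_bind (Part.mem_some _) (Part.mem_some _)

theorem pair_total {f h : ℕ → ℕ} (hf : Nat.RecursiveIn O f) (hh : Nat.RecursiveIn O h) :
    Nat.RecursiveIn O (fun n => Nat.pair (f n) (h n) : ℕ → ℕ) :=
  (hf.pair hh).of_eq fun n => by simp [Seq.seq]

theorem of_computable {f : ℕ → ℕ} (hf : Computable f) : Nat.RecursiveIn O f :=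
  Nat.Partrec.recursiveIn (Partrec.nat_iff.1 hf)

/-- Composition of a typed computable function with a coded one. -/
theorem comp_encode {α : Type*} [Primcodable α] {f : α → ℕ} (hf : Computable f) {h : ℕ → α}
    (hh : Nat.RecursiveIn O (fun n => Encodable.encode (h n) : ℕ → ℕ)) :
    Nat.RecursiveIn O (fun n => f (h n) : ℕ → ℕ) :=
  ((Nat.Partrec.recursiveIn hf).comp hh).of_eq fun n => by simp

theorem prec_total {H : ℕ →. ℕ} (hH : Nat.RecursiveIn O H) {τ : ℕ → ℕ}
    (h : ∀ s, τ (s + 1) ∈ H (Nat.pair 0 (Nat.pair s (τ s)))) : Nat.RecursiveIn O τ := by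
  have hinit : Nat.RecursiveIn O (fun _ => τ 0 : ℕ → ℕ) := of_computable (Computable.const _)
  have hpair : Nat.RecursiveIn O (fun n => Nat.pair 0 n : ℕ → ℕ) :=
    pair_total (of_computable (Computable.const 0)) (of_computable Computable.id)
  refine ((hinit.prec hH).comp hpair).of_eq_tot fun n => ?_
  refine Part.mem_bind (Part.mem_some _) ?_
  simp only [Nat.unpair_pair]
  induction n with
  | zero => exact Part.mem_some _
  | succ n ih => exact Part.mem_bind ih (h n)

/-- A sequence is computable in an oracle if each of its terms is obtained from the previous one
by a computable question to the oracle and a partial recursive treatment of the answer. -/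
theorem of_forall_succ_mem {α : Type*} [Primcodable α] {g : ℕ → ℕ} (hg : (g : ℕ →. ℕ) ∈ O)
    {q : ℕ × α → ℕ} (hq : Computable q) {T : (ℕ × α) × ℕ →. α} (hT : Partrec T) {σ : ℕ → α}
    (hσ : ∀ s, σ (s + 1) ∈ T ((s, σ s), g (q (s, σ s)))) :
    Nat.RecursiveIn O (fun n => Encodable.encode (σ n) : ℕ → ℕ) := by
  have hT' : Nat.RecursiveIn O _ := Nat.Partrec.recursiveIn hT
  have hq' : Computable fun n : ℕ => ((Encodable.decode n : Option (ℕ × α)).map q).getD 0 :=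
    Computable.option_getD (Computable.option_map Computable.decode (hq.comp Computable.snd).to₂)
      (Computable.const 0)
  have hr : Nat.RecursiveIn O (fun n => (Nat.unpair n).2 : ℕ → ℕ) := right
  refine prec_total (hT'.comp (pair_total hr ((oracle _ hg).comp_total
    ((of_computable hq').comp_total hr)))) fun s => ?_
  refine Part.mem_bind (Part.mem_some _) ?_
  have h : Nat.pair s (Encodable.encode (σ s)) = Encodable.encode (s, σ s) := rfl
  simp only [Nat.unpair_pair, h, Encodable.encodek, Option.map_some, Option.getD_some]
  have h' : Nat.pair (Encodable.encode (s, σ s)) (g (q (s, σ s))) =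
    Encodable.encode ((s, σ s), g (q (s, σ s))) := rfl
  rw [h', Encodable.encodek]
  exact Part.mem_bind (Part.mem_some _) (Part.mem_map _ (hσ s))

end Nat.RecursiveIn

/-! ### The stage construction -/

namespace HTP

open Primrec

theorem primrec_primeCounting : Primrec (Nat.count Nat.Prime) := by
  refine (Primrec.nat_rec₁ (f := fun n r => if n.Prime then r + 1 else r) 0
    (Primrec.ite (nat_prime.comp fst) (succ.comp snd) snd).to₂).of_eq fun n => ?_
  induction n with
  | zero => simp
  | succ n ih =>
    simp only at ih ⊢
    rw [ih, Nat.count_succ]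
    split_ifs <;> rfl

/-- The number of thresholds in the list `σ` which are at most `k`. -/
def block (σ : List ℕ) (k : ℕ) : ℕ := (σ.filter (· ≤ k)).length

theorem primrec_block : Primrec₂ block :=
  list_length.comp (filter_list (f := fun v : List ℕ × ℕ => v.1) (R := fun v b => b ≤ v.2) fst
    (nat_le.comp snd (snd.comp fst)))

/-- The primes below the last threshold which do not belong to the class of the stage `v.1`. -/
def excluded (m : ℕ) (v : ℕ × List ℕ) : List ℕ :=
  -- For the empty list `headI` is `0`, so stage `0` excludes nothing.
  (List.range v.2.headI).filter fun p => p.Prime ∧ block v.2 p % m ≠ v.1 % m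

theorem primrec_excluded (m : ℕ) : Primrec (excluded m) := by
  refine filter_list (f := fun v : ℕ × List ℕ => List.range v.2.headI)
    (R := fun v p => p.Prime ∧ block v.2 p % m ≠ v.1 % m)
    (list_range.comp (list_headI.comp snd)) ?_
  refine (nat_prime.comp snd).and (Primrec.eq.comp ?_ ?_).not
  · exact nat_mod.comp (primrec_block.comp (snd.comp fst) snd) (.const m)
  · exact nat_mod.comp (fst.comp fst) (.const m)

theorem prime_of_mem_excluded {m : ℕ} {v : ℕ × List ℕ} {p : ℕ} (h : p ∈ excluded m v) :
    p.Prime := by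
  simp only [excluded, List.mem_filter, decide_eq_true_eq] at h
  exact h.2.1

theorem exists_auxBound (F : List ℕ) :
    ∃ K, ∀ p ∈ F, p.Prime → ∃ c ∈ List.range K, IsAuxPrime p c := by
  choose! c hc using fun (p : ℕ) (hp : p.Prime) => exists_isAuxPrime hp
  refine ⟨(F.map c).sum + 1, fun p hp hp' => ⟨c p, ?_, hc p hp'⟩⟩
  rw [List.mem_range, Nat.lt_succ_iff]
  exact List.le_sum_of_mem (List.mem_map.2 ⟨p, hp, rfl⟩)

/-- A bound below which each prime in `F` has an auxiliary prime. -/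
def auxBound (F : List ℕ) : ℕ := Nat.find (exists_auxBound F)

theorem computable_auxBound : Computable auxBound := by
  refine Computable.find (P := fun (F : List ℕ) K => ∀ p ∈ F, p.Prime →
    ∃ c ∈ List.range K, IsAuxPrime p c) (PrimrecPred.computablePred ?_) exists_auxBound
  refine forall_mem (f := fun v : List ℕ × ℕ => v.1)
    (R := fun v p => p.Prime → ∃ c ∈ List.range v.2, IsAuxPrime p c) fst ?_
  refine PrimrecPred.of_eq (p := fun w : (List ℕ × ℕ) × ℕ => ¬ w.2.Prime ∨
    ∃ c ∈ List.range w.1.2, IsAuxPrime w.2 c) ((nat_prime.comp snd).not.or ?_) fun w => by tauto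
  exact exists_mem (list_range.comp (snd.comp fst))
    (primrecRel_isAuxPrime.comp (snd.comp fst) snd)

/-- The primes of `F` with their auxiliary primes below `K`. -/
def auxPairs (F : List ℕ) (K : ℕ) : List (ℕ × ℕ) :=
  F.flatMap fun p => ((List.range K).filter fun c => IsAuxPrime p c).map (p, ·)

theorem primrec_auxPairs : Primrec₂ auxPairs := by
  refine list_flatMap fst ?_
  refine list_map (filter_list (f := fun w : (List ℕ × ℕ) × ℕ => List.range w.1.2)
    (R := fun w c => IsAuxPrime w.2 c) (list_range.comp (snd.comp fst))
    (primrecRel_isAuxPrime.comp (snd.comp fst) snd)) ?_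
  exact Primrec.pair (snd.comp fst) snd

theorem mem_auxPairs {F : List ℕ} {K : ℕ} {q : ℕ × ℕ} :
    q ∈ auxPairs F K ↔ q.1 ∈ F ∧ q.2 < K ∧ IsAuxPrime q.1 q.2 := by
  obtain ⟨p, c⟩ := q
  simp only [auxPairs, List.mem_flatMap, List.mem_map, List.mem_filter, List.mem_range,
    decide_eq_true_eq, Prod.mk.injEq]
  constructor
  · rintro ⟨_, hp, _, hc, rfl, rfl⟩
    exact ⟨hp, hc⟩
  · rintro ⟨hp, hc⟩
    exact ⟨p, hp, c, hc, rfl, rfl⟩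

/-- The index of the polynomial about which the oracle is asked at the stage `v.1`. -/
def query (m : ℕ) (v : ℕ × List ℕ) : ℕ :=
  Encodable.encode ((Denumerable.ofNat PolyCode (v.1 / m)).localCode
    (auxPairs (excluded m v) (auxBound (excluded m v))))

theorem computable_query (m : ℕ) : Computable (query m) := by
  have he : Computable (excluded m) := (primrec_excluded m).to_comp
  refine Computable.encode.comp (PolyCode.primrec_localCode.to_comp.comp ?_
    (primrec_auxPairs.to_comp.comp he (computable_auxBound.comp he)))
  exact computable_code.comp (nat_div.comp fst (.const m)).to_comp

/-- `auxPairs` may attach several `c` to one `p`; each imposes the same condition at `p`, and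
`auxBound` ensures at least one. -/
theorem query_mem_iff {m : ℕ} {v : ℕ × List ℕ} :
    query m v ∈ hilbertTenth ℚ ↔ ∃ x : ℕ → ℚ, (Denumerable.ofNat PolyCode (v.1 / m)).eval x = 0 ∧
      ∀ j ∈ (Denumerable.ofNat PolyCode (v.1 / m)).vars, ∀ p ∈ excluded m v, ¬ p ∣ (x j).den := by
  rw [mem_hilbertTenth, query, Denumerable.ofNat_encode, PolyCode.exists_eval_localCode_eq_zero]
  · refine exists_congr fun x => and_congr_right fun _ => forall₂_congr fun j _ => ?_
    constructor
    · intro h p hp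
      obtain ⟨c, hc, hpc⟩ := Nat.find_spec (exists_auxBound (excluded m v)) p hp
        (prime_of_mem_excluded hp)
      exact h (p, c) (mem_auxPairs.2 ⟨hp, List.mem_range.1 hc, hpc⟩)
    · exact fun h q hq => h q.1 (mem_auxPairs.1 hq).1
  · exact fun q hq => ⟨prime_of_mem_excluded (mem_auxPairs.1 hq).1, (mem_auxPairs.1 hq).2.2⟩

/-- `w = (d, ys, b)` provides an admissible next threshold `b` at the stage `v.1.1`, where `v.1.2`
is the list of the thresholds so far and `v.2` is the answer of the oracle; if the answer is
positive, `ys / d` has to be a root. -/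
def IsNextThreshold (m : ℕ) (v : (ℕ × List ℕ) × ℕ) (w : ℕ × List ℤ × ℕ) : Prop :=
  w.1 ≠ 0 ∧ w.1 < w.2.2 ∧ v.1.2.headI < w.2.2 ∧
    (v.1.1 + 1) * (v.1.2.headI + 1) ≤ Nat.count Nat.Prime w.2.2 ∧
    (v.2 = 0 ∨ ((∀ p ∈ excluded m v.1, ¬ p ∣ w.1) ∧
      (Denumerable.ofNat PolyCode (v.1.1 / m)).homEval w.1 w.2.1 = 0))

theorem primrecRel_isNextThreshold (m : ℕ) : PrimrecRel (IsNextThreshold m) := by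
  let V := ((ℕ × List ℕ) × ℕ) × (ℕ × List ℤ × ℕ)
  have hd : Primrec fun z : V => z.2.1 := fst.comp snd
  have hy : Primrec fun z : V => z.2.2.1 := fst.comp (snd.comp snd)
  have hb : Primrec fun z : V => z.2.2.2 := snd.comp (snd.comp snd)
  have hs : Primrec fun z : V => z.1.1.1 := fst.comp (fst.comp fst)
  have hσ : Primrec fun z : V => z.1.1.2 := snd.comp (fst.comp fst)
  have hh : Primrec fun z : V => z.1.1.2.headI := list_headI.comp hσ
  refine (Primrec.eq.comp hd (.const 0)).not.and <| (nat_lt.comp hd hb).and <|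
    (nat_lt.comp hh hb).and <| (nat_le.comp (nat_mul.comp (succ.comp hs) (succ.comp hh))
      (primrec_primeCounting.comp hb)).and <|
    (Primrec.eq.comp (snd.comp fst) (.const 0)).or <| PrimrecPred.and ?_ ?_
  · exact forall_mem (f := fun z : V => excluded m z.1.1) (R := fun z p => ¬ p ∣ z.2.1)
      ((primrec_excluded m).comp (fst.comp fst)) (nat_dvd.comp snd (hd.comp fst)).not
  · exact Primrec.eq.comp (PolyCode.primrec_homEval.comp (Primrec.pair
      ((Primrec.ofNat PolyCode).comp (nat_div.comp hs (.const m))) (Primrec.pair hd hy))) (.const 0)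

theorem charFun_eq_zero_iff {A : Set ℕ} {n : ℕ} : charFun A n = 0 ↔ n ∉ A := by
  simp [charFun]

/-- The search for a threshold terminates when the oracle answer is truthful: a positive answer
guarantees a root to find. -/
theorem exists_isNextThreshold (m : ℕ) (v : ℕ × List ℕ) :
    ∃ n, IsNextThreshold m (v, charFun (hilbertTenth ℚ) (query m v))
      (Denumerable.ofNat (ℕ × List ℤ × ℕ) n) := by
  suffices h : ∃ w, IsNextThreshold m (v, charFun (hilbertTenth ℚ) (query m v)) w by
    obtain ⟨w, hw⟩ := h
    exact ⟨Encodable.encode w, by rwa [Denumerable.ofNat_encode]⟩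
  obtain ⟨d, ys, hd, h⟩ : ∃ (d : ℕ) (ys : List ℤ), d ≠ 0 ∧
      (charFun (hilbertTenth ℚ) (query m v) = 0 ∨ ((∀ p ∈ excluded m v, ¬ p ∣ d) ∧
        (Denumerable.ofNat PolyCode (v.1 / m)).homEval d ys = 0)) := by
    by_cases hv : query m v ∈ hilbertTenth ℚ
    · obtain ⟨x, hx, hden⟩ := query_mem_iff.1 hv
      obtain ⟨d, hd, hF, ys, hys⟩ :=
        PolyCode.exists_homEval_eq_zero (fun p hp => prime_of_mem_excluded hp) hx hden
      exact ⟨d, ys, hd, Or.inr ⟨hF, hys⟩⟩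
    · exact ⟨1, [], one_ne_zero, Or.inl (charFun_eq_zero_iff.2 hv)⟩
  set N := (v.1 + 1) * (v.2.headI + 1) with hN
  refine ⟨(d, ys, d + v.2.headI + Nat.nth Nat.Prime N + 1), hd, ?_, ?_, ?_, h⟩
  · dsimp only
    omega
  · dsimp only
    omega
  · calc N = Nat.count Nat.Prime (Nat.nth Nat.Prime N) :=
          (Nat.count_nth_of_infinite Nat.infinite_setOfPred_prime N).symm
      _ ≤ _ := Nat.count_monotone _ (by dsimp only; omega)

open scoped Classical in
/-- The list of the thresholds, the last one first, after the first `s` stages. -/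
noncomputable def thresholds (m : ℕ) : ℕ → List ℕ
  | 0 => []
  | s + 1 => (Denumerable.ofNat (ℕ × List ℤ × ℕ)
      (Nat.find (exists_isNextThreshold m (s, thresholds m s)))).2.2 :: thresholds m s

theorem recursiveIn_thresholds (m : ℕ) :
    Nat.RecursiveIn {(charFun (hilbertTenth ℚ) : ℕ →. ℕ)}
      (fun s => Encodable.encode (thresholds m s) : ℕ → ℕ) := by
  classical
  have hR : PrimrecRel fun (v : (ℕ × List ℕ) × ℕ) n =>
      IsNextThreshold m v (Denumerable.ofNat (ℕ × List ℤ × ℕ) n) :=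
    (primrecRel_isNextThreshold m).comp fst ((Primrec.ofNat _).comp snd)
  have hT : Partrec fun v : (ℕ × List ℕ) × ℕ => (Nat.rfind fun n => Part.some (decide
      (IsNextThreshold m v (Denumerable.ofNat (ℕ × List ℤ × ℕ) n)))).map fun n =>
      (Denumerable.ofNat (ℕ × List ℤ × ℕ) n).2.2 :: v.1.2 := by
    refine (Partrec.rfind (p := fun v n => Part.some (decide
      (IsNextThreshold m v (Denumerable.ofNat (ℕ × List ℤ × ℕ) n))))
      hR.decide.to_comp.partrec).map ?_
    exact (list_cons.comp (snd.comp (snd.comp ((Primrec.ofNat _).comp snd)))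
      (snd.comp (fst.comp fst))).to_comp
  -- The search is a partial function of the answer, since a false positive could make it diverge;
  -- only its value at the true answer is needed.
  refine Nat.RecursiveIn.of_forall_succ_mem (Set.mem_singleton _) (computable_query m) hT fun s => ?_
  refine Part.mem_map _ (Nat.mem_rfind.2 ⟨?_, fun {k} hk => ?_⟩)
  · have := Nat.find_spec (exists_isNextThreshold m (s, thresholds m s))
    simpa using this
  · have := Nat.find_min (exists_isNextThreshold m (s, thresholds m s)) hk
    simpa using this

/-- The threshold reached after `s` stages. -/
noncomputable def threshold (m s : ℕ) : ℕ := (thresholds m s).headI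

theorem exists_isNextThreshold_threshold (m s : ℕ) : ∃ d ys,
    IsNextThreshold m ((s, thresholds m s), charFun (hilbertTenth ℚ) (query m (s, thresholds m s)))
      (d, ys, threshold m (s + 1)) := by
  classical
  exact ⟨_, _, Nat.find_spec (exists_isNextThreshold m (s, thresholds m s))⟩

theorem thresholds_succ (m s : ℕ) :
    thresholds m (s + 1) = threshold m (s + 1) :: thresholds m s := rfl

theorem threshold_strictMono (m : ℕ) : StrictMono (threshold m) := by
  refine strictMono_nat_of_lt_succ fun s => ?_
  obtain ⟨d, ys, h⟩ := exists_isNextThreshold_threshold m s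
  exact h.2.2.1

theorem mul_le_count_threshold (m s : ℕ) :
    (s + 1) * (threshold m s + 1) ≤ Nat.count Nat.Prime (threshold m (s + 1)) := by
  obtain ⟨d, ys, h⟩ := exists_isNextThreshold_threshold m s
  exact h.2.2.2.1

/-- The stage at which the prime `p` is put into one of the classes. -/
noncomputable def stage (m p : ℕ) : ℕ := block (thresholds m (p + 1)) p

theorem block_thresholds_succ {m s p : ℕ} (h : p < threshold m (s + 1)) :
    block (thresholds m (s + 1)) p = block (thresholds m s) p := by
  rw [thresholds_succ, block, List.filter_cons_of_neg (by simpa using h), block]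

theorem block_thresholds {m s p : ℕ} (h : p < threshold m s) :
    block (thresholds m s) p = stage m p := by
  have key : ∀ s t, p < threshold m s → s ≤ t →
      block (thresholds m t) p = block (thresholds m s) p := by
    intro s t h hst
    induction t, hst using Nat.le_induction with
    | base => rfl
    | succ t hst ih =>
      rw [block_thresholds_succ (h.trans_le ((threshold_strictMono m).monotone (by omega))), ih]
  have hp : p < threshold m (p + 1) := (threshold_strictMono m).le_apply
  rcases le_total s (p + 1) with h1 | h1
  · exact (key _ _ h h1).symm
  · exact key _ _ hp h1

theorem stage_eq {m s p : ℕ} (h1 : threshold m s ≤ p) (h2 : p < threshold m (s + 1)) :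
    stage m p = s := by
  rw [← block_thresholds h2, block_thresholds_succ h2]
  have key : ∀ s, threshold m s ≤ p → block (thresholds m s) p = s := by
    intro s
    induction s with
    | zero => intro _; rfl
    | succ s ih =>
      intro h
      rw [thresholds_succ, block, List.filter_cons_of_pos (by simpa using h), List.length_cons]
      exact congrArg (· + 1) (ih (((threshold_strictMono m).monotone (by omega)).trans h))
  exact key s h1

theorem mem_excluded {m s p : ℕ} : p ∈ excluded m (s, thresholds m s) ↔
    p < threshold m s ∧ p.Prime ∧ stage m p % m ≠ s % m := by
  simp only [excluded, List.mem_filter, List.mem_range, decide_eq_true_eq]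
  refine and_congr_right fun h => ?_
  rw [block_thresholds h]

/-! ### The classes and their reductions to `HTP(ℚ)` -/

/-- The classes into which the primes are divided. -/
def primeClass (m i : ℕ) : Set ℕ := {p | p.Prime ∧ stage m p % m = i}

theorem mem_hilbertTenth_primeClass_iff {m i : ℕ} (hi : i < m) (e : ℕ) :
    e ∈ hilbertTenth (invertedSubring (primeClass m i)) ↔
      query m (m * e + i, thresholds m (m * e + i)) ∈ hilbertTenth ℚ := by
  set s := m * e + i with hs
  have hdiv : s / m = e := by
    rw [hs, Nat.mul_add_div (by omega), Nat.div_eq_of_lt hi, add_zero]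
  have hmod : s % m = i := by rw [hs, Nat.mul_add_mod, Nat.mod_eq_of_lt hi]
  rw [mem_hilbertTenth_subring]
  constructor
  · rintro ⟨x, hxA, hx⟩
    refine query_mem_iff.2 ⟨x, by rwa [hdiv], fun j _ p hp => ?_⟩
    obtain ⟨-, hp, hps⟩ := mem_excluded.1 hp
    exact not_dvd_den_of_mem_invertedSubring (fun q hq => hq.1) hp
      (fun h => hps (h.2.trans hmod.symm)) (hxA j)
  · intro h
    obtain ⟨d, ys, hd0, hdlt, -, -, h0 | ⟨hF, hy⟩⟩ := exists_isNextThreshold_threshold m s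
    · exact absurd h (charFun_eq_zero_iff.1 h0)
    · rw [PolyCode.homEval_eq_zero_iff _ hd0] at hy
      simp only [hdiv] at hy
      have hS : ∀ p, p.Prime → p ∣ d → p ∈ primeClass m i := fun p hp hpd => ⟨hp, ?_⟩
      · exact ⟨_, fun j => mem_invertedSubring_of_den hd0 hS _, hy⟩
      -- A prime divisor of `d` below the old threshold is not excluded, hence already in class `i`;
      -- any other lies below the new threshold and is assigned at stage `s`.
      rcases lt_or_ge p (threshold m s) with hlt | hge
      · by_contra hne
        exact hF p (mem_excluded.2 ⟨hlt, hp, fun h => hne (h.trans hmod)⟩) hpd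
      · rw [stage_eq hge ((Nat.le_of_dvd (Nat.pos_of_ne_zero hd0) hpd).trans_lt hdlt), hmod]

theorem hilbertTenth_primeClass_reducible {m i : ℕ} (hi : i < m) :
    SetTuringReducible (hilbertTenth (invertedSubring (primeClass m i))) (hilbertTenth ℚ) := by
  refine RecursiveIn.iff_nat.2 ?_
  have hs : Computable fun e => m * e + i :=
    (nat_add.comp (nat_mul.comp (.const m) .id) (.const i)).to_comp
  have h1 := Nat.RecursiveIn.pair_total (Nat.RecursiveIn.of_computable hs)
    ((recursiveIn_thresholds m).comp_total (Nat.RecursiveIn.of_computable hs))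
  have h2 := Nat.RecursiveIn.comp_encode (computable_query m)
    (h := fun e => (m * e + i, thresholds m (m * e + i))) h1
  have h3 := (Nat.RecursiveIn.oracle _ (Set.mem_singleton _)).comp_total h2
  refine h3.of_eq fun e => ?_
  have := mem_hilbertTenth_primeClass_iff hi e
  by_cases he : e ∈ hilbertTenth (invertedSubring (primeClass m i))
  · simp [charFun, he, this.1 he]
  · simp [charFun, he, mt this.2 he]

theorem primeClass_reducible (m i : ℕ) :
    SetTuringReducible (primeClass m i) (hilbertTenth ℚ) := by
  refine RecursiveIn.iff_nat.2 ?_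
  have h1 := Nat.RecursiveIn.pair_total (Nat.RecursiveIn.of_computable Computable.id)
    ((recursiveIn_thresholds m).comp_total (Nat.RecursiveIn.of_computable Computable.succ))
  have h2 : Computable fun v : ℕ × List ℕ =>
      if v.1.Prime ∧ block v.2 v.1 % m = i then 1 else 0 :=
    (Primrec.ite ((nat_prime.comp fst).and (Primrec.eq.comp
      (nat_mod.comp (primrec_block.comp snd fst) (.const m)) (.const i)))
      (.const 1) (.const 0)).to_comp
  refine (Nat.RecursiveIn.comp_encode h2 (h := fun p => (p, thresholds m (p + 1))) h1).of_eq
    fun p => ?_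
  simp [charFun, Set.indicator_apply, primeClass, stage]

/-! ### Upper density -/

open scoped Classical in
-- The `k`-th prime is at least `k`, so at most `threshold m s` primes precede the interval assigned
-- at stage `s`.
theorem count_sub_threshold_le_card {m s : ℕ} :
    Nat.count Nat.Prime (threshold m (s + 1)) - threshold m s ≤
      ((Finset.range (Nat.count Nat.Prime (threshold m (s + 1)))).filter fun k =>
        Nat.nth Nat.Prime k ∈ primeClass m (s % m)).card := by
  rw [← Nat.card_Ico]
  refine Finset.card_le_card fun l hl => ?_
  rw [Finset.mem_Ico] at hl
  refine Finset.mem_filter.2 ⟨Finset.mem_range.2 hl.2, Nat.prime_nth_prime l, ?_⟩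
  rw [stage_eq (hl.1.trans (Nat.nth_strictMono Nat.infinite_setOfPred_prime).le_apply)
    (Nat.nth_lt_of_lt_count hl.2)]

open scoped Classical in
theorem exists_one_sub_le_ratio {m i : ℕ} (hi : i < m) {ε : ℝ} (hε : 0 < ε) (N : ℕ) :
    ∃ n ≥ N, 1 - ε ≤ (((Finset.range n).filter fun k =>
      Nat.nth Nat.Prime k ∈ primeClass m i).card : ℝ) / (n : ℝ) := by
  obtain ⟨k, hk⟩ := exists_nat_gt (1 / ε)
  obtain ⟨s, hks, rfl⟩ : ∃ s, k + N ≤ s ∧ s % m = i :=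
    ⟨m * (k + N) + i, le_add_right (Nat.le_mul_of_pos_left _ (by omega)),
      by rw [Nat.mul_add_mod, Nat.mod_eq_of_lt hi]⟩
  have hmul := mul_le_count_threshold m s
  have hcard := count_sub_threshold_le_card (m := m) (s := s)
  generalize Nat.count Nat.Prime (threshold m (s + 1)) = n at *
  generalize threshold m s = t at *
  have hsn : s + 1 ≤ n := le_trans (Nat.le_mul_of_pos_right _ (by omega)) hmul
  refine ⟨n, by omega, ?_⟩
  have hn0 : (0 : ℝ) < n := by exact_mod_cast (by omega : 0 < n)
  rw [le_div_iff₀ hn0]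
  have h1 : (n : ℝ) - t ≤ (((Finset.range n).filter fun k =>
      Nat.nth Nat.Prime k ∈ primeClass m (s % m)).card : ℝ) := by
    rw [sub_le_iff_le_add]
    exact_mod_cast Nat.sub_le_iff_le_add.1 hcard
  have h2 : ((s : ℝ) + 1) * (t + 1) ≤ n := by exact_mod_cast hmul
  have h3 : (k : ℝ) ≤ s + 1 := by exact_mod_cast (by omega : k ≤ s + 1)
  have h4 : 1 ≤ ε * (s + 1) :=
    ((div_lt_iff₀' hε).1 hk).le.trans (mul_le_mul_of_nonneg_left h3 hε.le)
  have h5 : (t : ℝ) ≤ ε * n :=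
    calc (t : ℝ) ≤ 1 * (t + 1) := by linarith
      _ ≤ ε * (s + 1) * (t + 1) := mul_le_mul_of_nonneg_right h4 (by positivity)
      _ ≤ ε * n := by
        rw [mul_assoc]
        exact mul_le_mul_of_nonneg_left h2 hε.le
  linarith

theorem primeUpperDensity_primeClass {m i : ℕ} (hi : i < m) :
    primeUpperDensity (primeClass m i) = 1 := by
  classical
  rw [primeUpperDensity]
  have hle : ∀ n : ℕ, (((Finset.range n).filter fun k =>
      Nat.nth Nat.Prime k ∈ primeClass m i).card : ℝ) / (n : ℝ) ≤ 1 := by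
    intro n
    refine div_le_one_of_le₀ ?_ n.cast_nonneg
    exact_mod_cast (Finset.card_filter_le _ _).trans (Finset.card_range n).le
  refine le_antisymm ?_ (le_of_forall_sub_le fun ε hε => ?_)
  -- The real `limsup` is meaningful only for bounded ratios; they lie between `0` and `1`.
  · refine Filter.limsup_le_of_le ⟨0, fun b hb => ?_⟩ (Filter.Eventually.of_forall hle)
    obtain ⟨n, hn⟩ := (Filter.eventually_map.1 hb).exists
    exact le_trans (by positivity) hn
  · refine Filter.le_limsup_of_frequently_le (Filter.frequently_atTop.2 fun N => ?_)
      ⟨1, Filter.eventually_map.2 (.of_forall hle)⟩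
    exact exists_one_sub_le_ratio hi hε N

end HTP

theorem mainTheorem3 (m : ℕ) (hm : 1 ≤ m) :
    ∃ S : Fin m → Set ℕ,
      (⋃ i, S i) = {p : ℕ | p.Prime} ∧
      Pairwise (fun i j => Disjoint (S i) (S j)) ∧
      ∀ i, primeUpperDensity (S i) = 1 ∧
        SetTuringReducible (hilbertTenth (invertedSubring (S i))) (hilbertTenth ℚ) ∧
        SetTuringReducible (S i) (hilbertTenth ℚ) := by
  refine ⟨fun i => HTP.primeClass m i, ?_, ?_, fun i => ⟨HTP.primeUpperDensity_primeClass i.2,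
    HTP.hilbertTenth_primeClass_reducible i.2, HTP.primeClass_reducible m i⟩⟩
  · ext p
    simp only [Set.mem_iUnion, Set.mem_ofPred_eq]
    exact ⟨fun ⟨i, hi⟩ => hi.1, fun hp => ⟨⟨HTP.stage m p % m, Nat.mod_lt _ hm⟩, hp, rfl⟩⟩
  · intro i j hij
    exact Set.disjoint_left.2 fun p hi hj => hij (Fin.ext (hi.2.symm.trans hj.2))
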